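/- Work on a randomized word RAM (unit-cost integer arithmetic, comparisons, memory accesses and fair coin tosses on words of $w$ bits). For a 0-1 matrix $A$ of size $p\times q$ let $\lambda(A,\ell,\mathrm{row})$ be the minimum, over all choices of $\ell$ (not necessarily distinct) centers in $\{0,1\}^q$, of the maximum Hamming distance between a row of $A$ and the closest center; for a 0-1 matrix $B$ of size $q\times r$ define $\lambda(B,k,\mathrm{col})$ in the same way for the columns of $B$. **Theorem.** For every constant $\alpha\ge 1$ there are a randomized algorithm and constants $c,K$, depending only on $\alpha$, such that the following holds for all 0-1 matrices $A$ and $B$ of sizes $p\times q$ and $q\times r$, all integers $1\le \ell\le p$ and $1\le k\le r$, all real $\epsilon\in(0,1/2)$, and every word length $w\ge c\,\mathrm{size}(p+q+r+\lceil 1/\epsilon\rceil)$, where $\mathrm{size}(n)$ is the number of binary digits of $n$. Given $p,q,r,\ell,k$, the precision $\lceil 1/\epsilon\rceil$, $A$ and $B$, the algorithm always halts within time $$K\left(\frac{p\log p\,(q+\ell)}{\epsilon^2}+\frac{r\log r\,(q+k)}{\epsilon^2}+\ell qk+pr\right),$$ and with probability at least $1-(p+r)^{-\alpha}$ its output is a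 $p\times r$ matrix $D$ such that 1. $D_{ij}=(A'B')_{\sigma(i)\tau(j)}$ for all $i,j$, for some 0-1 matrices $A'$ (of size $\ell\times q$) and $B'$ (of size $q\times k$) of centers and some assignments $\sigma$ of rows and $\tau$ of columns to centers for which every row $i$ of $A$ is within Hamming distance $(2+\epsilon)\lambda(A,\ell,\mathrm{row})$ of row $\sigma(i)$ of $A'$, and every column $j$ of $B$ is within Hamming distance $(2+\epsilon)\lambda(B,k,\mathrm{col})$ of column $\tau(j)$ of $B'$; 2. every entry of $D$ differs from the corresponding entry of the arithmetic product $AB$ by at most $(2+\epsilon)\bigl(\lambda(A,\ell,\mathrm{row})+\lambda(B,k,\mathrm{col})\bigr)$. -/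

import Mathlib

/-! ## Clustering in Hamming space -/

/-- The optimal value of the `ℓ`-center problem for the rows of the 0-1 matrix `A`: the minimum over
all choices of `ℓ` centers in `{0,1}^q` of the maximum over the rows of the Hamming distance to the
closest center. The centers need not be rows of `A`. -/
noncomputable def rowRadius {p q : ℕ} (A : Matrix (Fin p) (Fin q) Bool) (ℓ : ℕ) : ℕ :=
  ⨅ T : Fin ℓ → (Fin q → Bool), ⨆ i : Fin p, ⨅ j : Fin ℓ, hammingDist (A i) (T j)

/-- The optimal value of the `k`-center problem for the columns of the 0-1 matrix `B`. -/
noncomputable def colRadius {q r : ℕ} (B : Matrix (Fin q) (Fin r) Bool) (k : ℕ) : ℕ :=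
  ⨅ T : Fin k → (Fin q → Bool), ⨆ j : Fin r, ⨅ i : Fin k, hammingDist (fun m => B m j) (T i)

/-- The arithmetic matrix product of two 0-1 matrices. -/
def arithProd {p q r : ℕ} (A : Matrix (Fin p) (Fin q) Bool) (B : Matrix (Fin q) (Fin r) Bool) :
    Matrix (Fin p) (Fin r) ℕ :=
  A.map Bool.toNat * B.map Bool.toNat

/-- `D` is obtained from a `(2 + ε)`-approximate `ℓ`-center clustering of the rows of `A` and a
`(2 + ε)`-approximate `k`-center clustering of the columns of `B` by multiplying the matrices
`A'` and `B'` of the centers: `σ` and `τ` tell to which center a row or a column is assigned. -/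
def IsCenterProduct {p q r : ℕ} (A : Matrix (Fin p) (Fin q) Bool) (B : Matrix (Fin q) (Fin r) Bool)
    (ℓ k : ℕ) (ε : ℝ) (D : Matrix (Fin p) (Fin r) ℕ) : Prop :=
  ∃ (A' : Matrix (Fin ℓ) (Fin q) Bool) (B' : Matrix (Fin q) (Fin k) Bool)
    (σ : Fin p → Fin ℓ) (τ : Fin r → Fin k),
    (∀ i, (hammingDist (A i) (A' (σ i)) : ℝ) ≤ (2 + ε) * rowRadius A ℓ) ∧
    (∀ j, (hammingDist (fun m => B m j) (fun m => B' m (τ j)) : ℝ) ≤ (2 + ε) * colRadius B k) ∧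
    (∀ i j, D i j = arithProd A' B' (σ i) (τ j))

/-! ## A randomized word RAM

The machine has variables (registers) and random-access arrays, both indexed by the constants of
the program, so that a program uses finitely many of them. All results of operations are words of
`w` bits, and every operation, memory access, test and coin toss costs one time unit. -/

/-- The arithmetic operations and comparisons of the machine. -/
inductive BinOp
  | add | sub | mul | div | mod | lt | eq

/-- The value of an operation before reduction to a word. Subtraction is truncated at `0`, division
by `0` gives `0`, and comparisons give `0` or `1`. -/
def BinOp.eval : BinOp → ℕ → ℕ → ℕ
  | .add, a, b => a + b
  | .sub, a, b => a - b
  | .mul, a, b => a * b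
  | .div, a, b => a / b
  | .mod, a, b => a % b
  | .lt, a, b => if a < b then 1 else 0
  | .eq, a, b => if a = b then 1 else 0

/-- Expressions: constants, variables, the array entry `a[e]`, and operations. -/
inductive Expr
  | const (n : ℕ)
  | var (x : ℕ)
  | load (a : ℕ) (e : Expr)
  | op (o : BinOp) (e f : Expr)

/-- Programs. `toss x` writes a fair random bit to the variable `x`. -/
inductive Cmd
  | skip
  | assign (x : ℕ) (e : Expr)
  | store (a : ℕ) (i e : Expr)
  | toss (x : ℕ)
  | seq (c d : Cmd)
  | ite (e : Expr) (c d : Cmd)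
  | loop (e : Expr) (c : Cmd)

/-- Memory: the variables, the arrays, and the number of coins tossed so far. -/
structure MemState where
  vars : ℕ → ℕ
  arr : ℕ → ℕ → ℕ
  tossed : ℕ

/-- The value of an expression on the machine with words of `w` bits: constants and results of
operations are reduced modulo `2 ^ w`. -/
def Expr.eval (w : ℕ) (s : MemState) : Expr → ℕ
  | .const n => n % 2 ^ w
  | .var x => s.vars x
  | .load a e => s.arr a (e.eval w s)
  | .op o e f => o.eval (e.eval w s) (f.eval w s) % 2 ^ w

/-- The cost of evaluating an expression: one unit for each of its nodes. -/
def Expr.cost : Expr → ℕ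
  | .const _ => 1
  | .var _ => 1
  | .load _ e => e.cost + 1
  | .op _ e f => e.cost + f.cost + 1

/-- `Exec w ω c s t s'`: on the machine with words of `w` bits and coin tosses `ω 0, ω 1, …`, the
program `c` started in the memory `s` halts after exactly `t` time units in the memory `s'`. -/
inductive Exec (w : ℕ) (ω : ℕ → Bool) : Cmd → MemState → ℕ → MemState → Prop
  | skip (s : MemState) : Exec w ω .skip s 1 s
  | assign (x : ℕ) (e : Expr) (s : MemState) :
      Exec w ω (.assign x e) s (e.cost + 1)
        { s with vars := Function.update s.vars x (e.eval w s) }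
  | store (a : ℕ) (i e : Expr) (s : MemState) :
      Exec w ω (.store a i e) s (i.cost + e.cost + 1)
        { s with arr := Function.update s.arr a
                  (Function.update (s.arr a) (i.eval w s) (e.eval w s)) }
  | toss (x : ℕ) (s : MemState) :
      Exec w ω (.toss x) s 1
        { s with vars := Function.update s.vars x (ω s.tossed).toNat, tossed := s.tossed + 1 }
  | seq {c d : Cmd} {s s' s'' : MemState} {t u : ℕ} :
      Exec w ω c s t s' → Exec w ω d s' u s'' → Exec w ω (.seq c d) s (t + u) s''
  | ite_true {e : Expr} {c d : Cmd} {s s' : MemState} {t : ℕ} :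
      e.eval w s ≠ 0 → Exec w ω c s t s' → Exec w ω (.ite e c d) s (e.cost + 1 + t) s'
  | ite_false {e : Expr} {c d : Cmd} {s s' : MemState} {t : ℕ} :
      e.eval w s = 0 → Exec w ω d s t s' → Exec w ω (.ite e c d) s (e.cost + 1 + t) s'
  | loop_stop {e : Expr} {c : Cmd} {s : MemState} :
      e.eval w s = 0 → Exec w ω (.loop e c) s (e.cost + 1) s
  | loop_step {e : Expr} {c : Cmd} {s s' s'' : MemState} {t u : ℕ} :
      e.eval w s ≠ 0 → Exec w ω c s t s' → Exec w ω (.loop e c) s' u s'' →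
      Exec w ω (.loop e c) s (e.cost + 1 + t + u) s''

/-- For given coin tosses a program has at most one terminating run. -/
theorem Exec.deterministic {w : ℕ} {ω : ℕ → Bool} {c : Cmd} {s s₁ s₂ : MemState} {t₁ t₂ : ℕ}
    (h₁ : Exec w ω c s t₁ s₁) (h₂ : Exec w ω c s t₂ s₂) : t₁ = t₂ ∧ s₁ = s₂ := by
  induction h₁ generalizing t₂ s₂ with
  | skip => cases h₂; exact ⟨rfl, rfl⟩
  | assign => cases h₂; exact ⟨rfl, rfl⟩
  | store => cases h₂; exact ⟨rfl, rfl⟩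
  | toss => cases h₂; exact ⟨rfl, rfl⟩
  | seq _ _ ih ih' =>
    cases h₂ with
    | seq a b =>
      obtain ⟨rfl, rfl⟩ := ih a
      obtain ⟨rfl, rfl⟩ := ih' b
      exact ⟨rfl, rfl⟩
  | ite_true h _ ih =>
    cases h₂ with
    | ite_true _ a => obtain ⟨rfl, rfl⟩ := ih a; exact ⟨rfl, rfl⟩
    | ite_false h' _ => exact absurd h' h
  | ite_false h _ ih =>
    cases h₂ with
    | ite_true h' _ => exact absurd h h'
    | ite_false _ a => obtain ⟨rfl, rfl⟩ := ih a; exact ⟨rfl, rfl⟩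
  | loop_stop h =>
    cases h₂ with
    | loop_stop _ => exact ⟨rfl, rfl⟩
    | loop_step h' _ _ => exact absurd h h'
  | loop_step h _ _ ih ih' =>
    cases h₂ with
    | loop_stop h' => exact absurd h' h
    | loop_step _ a b =>
      obtain ⟨rfl, rfl⟩ := ih a
      obtain ⟨rfl, rfl⟩ := ih' b
      exact ⟨rfl, rfl⟩

/-- The law of an infinite sequence of independent fair coin tosses. -/
noncomputable def coinMeasure : MeasureTheory.Measure (ℕ → Bool) :=
  MeasureTheory.Measure.infinitePi fun _ => (PMF.uniformOfFintype Bool).toMeasure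

/-! ## Input and output -/

/-- The array that holds a 0-1 matrix in row-major order, followed by zeros. -/
def flatten {m n : ℕ} (M : Matrix (Fin m) (Fin n) Bool) (x : ℕ) : ℕ :=
  if h : x < m * n then
    (M (finProdFinEquiv.symm ⟨x, h⟩).1 (finProdFinEquiv.symm ⟨x, h⟩).2).toNat
  else 0

/-- The initial memory: the variables `0, …, 5` hold `p, q, r, ℓ, k, e`, the arrays `0` and `1` hold
`A` and `B`, and everything else is `0`. -/
def inputState {p q r : ℕ} (A : Matrix (Fin p) (Fin q) Bool) (B : Matrix (Fin q) (Fin r) Bool)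
    (ℓ k e : ℕ) : MemState where
  vars
    | 0 => p
    | 1 => q
    | 2 => r
    | 3 => ℓ
    | 4 => k
    | 5 => e
    | _ => 0
  arr
    | 0 => flatten A
    | 1 => flatten B
    | _ => fun _ => 0
  tossed := 0

/-- The output matrix: array `2`, read in row-major order. -/
def outputMatrix (p r : ℕ) (s : MemState) : Matrix (Fin p) (Fin r) ℕ :=
  fun i j => s.arr 2 (i * r + j)

/-! For a random 0-1 vector `R`, the numbers of agreements of `x` and of `y` with `R` differ by a
sum of the entries of `x - y` with independent random signs (`cast_projDist`). The square of this
difference has mean equal to the Hamming distance of `x` and `y`. Averaging over `t = C e² log₂ (p +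
r - 1) + 1` vectors, where `e = ⌈1/ε⌉`, gives all distances between rows and all distances between
columns up to a factor `1 ± δ`, `δ = 1 / (8 e)`, outside an event of probability at most `(p + r) ^
(-α)`. This is a Chernoff bound built on `sum_exp_sq_le` and `sum_exp_neg_sq_le`, followed by a
union bound (`coinMeasure_not_accurate_le`, `failure_probability_le`).

Farthest-first traversal on the projected squared distances loses a factor two. The `m` centers and
any point `u` are `m + 1` points with mutual distances at least the distance of `u` to its center,
and two of them share an optimal cluster, so that their Hamming distance is at most twice the
optimum (`FarthestFirst.near_le_of_cluster`). The triangle inequality is applied to Hamming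
distances only, so squaring and distortion of the computed distances do no harm. Replacing rows and
columns by their centers changes an entry of the product by at most the two Hamming distances
(`abs_arithProd_sub_le`).

The program is verified in a Hoare logic with time bounds, `Runs`. For every coin sequence it halts
in time and performs a farthest-first traversal for `projDist` (`runs_approxMultiply`); chance
enters only through `Accurate`. In the time bound, `log (p + r)` has to be charged to `p log p` and
`r log r`, which vanish at `1` (`log_mul_le`). -/

/-! ## Reasoning about programs -/

/-- The memory with the variable `x` set to `v`. -/
def MemState.setVar (s : MemState) (x v : ℕ) : MemState :=
  { s with vars := Function.update s.vars x v }

/-- The memory with the array entry `a[i]` set to `v`. -/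
def MemState.setArr (s : MemState) (a i v : ℕ) : MemState :=
  { s with arr := Function.update s.arr a (Function.update (s.arr a) i v) }

namespace MemState

@[simp] theorem vars_setVar (s : MemState) (x v y : ℕ) :
    (s.setVar x v).vars y = if y = x then v else s.vars y := by
  simp [setVar, Function.update_apply]

@[simp] theorem arr_setVar (s : MemState) (x v : ℕ) : (s.setVar x v).arr = s.arr := rfl

@[simp] theorem tossed_setVar (s : MemState) (x v : ℕ) : (s.setVar x v).tossed = s.tossed := rfl

@[simp] theorem vars_setArr (s : MemState) (a i v : ℕ) : (s.setArr a i v).vars = s.vars := rfl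

@[simp] theorem tossed_setArr (s : MemState) (a i v : ℕ) : (s.setArr a i v).tossed = s.tossed := rfl

@[simp] theorem arr_setArr (s : MemState) (a i v b j : ℕ) :
    (s.setArr a i v).arr b j = if b = a ∧ j = i then v else s.arr b j := by
  by_cases h : b = a
  · subst h; simp [setArr, Function.update_apply]
  · simp [setArr, h]

end MemState

/-- The value of an expression in exact arithmetic. -/
def Expr.val (s : MemState) : Expr → ℕ
  | .const n => n
  | .var x => s.vars x
  | .load a e => s.arr a (e.val s)
  | .op o e f => o.eval (e.val s) (f.val s)

/-- No operation in the expression overflows. -/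
def Expr.Fits (w : ℕ) (s : MemState) : Expr → Prop
  | .const n => n < 2 ^ w
  | .var _ => True
  | .load _ e => e.Fits w s
  | .op o e f => e.Fits w s ∧ f.Fits w s ∧ o.eval (e.val s) (f.val s) < 2 ^ w

/-- Without overflow the reductions modulo `2 ^ w` are invisible. Programs can thus be verified in
exact arithmetic, and the word length survives only in side conditions. -/
theorem Expr.Fits.eval_eq {w : ℕ} {s : MemState} {e : Expr} (h : e.Fits w s) :
    e.eval w s = e.val s := by
  induction e with
  | const n => exact Nat.mod_eq_of_lt h
  | var x => rfl
  | load a e ih => simp only [Expr.eval, Expr.val, ih h]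
  | op o e f ihe ihf =>
    obtain ⟨he, hf, h⟩ := h
    simp only [Expr.eval, Expr.val, ihe he, ihf hf, Nat.mod_eq_of_lt h]

/-- The variables that a program may write. -/
def Cmd.wvars : Cmd → List ℕ
  | .skip => []
  | .assign x _ => [x]
  | .store _ _ _ => []
  | .toss x => [x]
  | .seq c d => c.wvars ++ d.wvars
  | .ite _ c d => c.wvars ++ d.wvars
  | .loop _ c => c.wvars

/-- The arrays that a program may write. -/
def Cmd.warrs : Cmd → List ℕ
  | .skip => []
  | .assign _ _ => []
  | .store a _ _ => [a]
  | .toss _ => []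
  | .seq c d => c.warrs ++ d.warrs
  | .ite _ c d => c.warrs ++ d.warrs
  | .loop _ c => c.warrs

/-- The two memories agree except where `c` may write. -/
structure Cmd.Frame (c : Cmd) (s s' : MemState) : Prop where
  vars : ∀ y, y ∉ c.wvars → s'.vars y = s.vars y
  arr : ∀ a, a ∉ c.warrs → s'.arr a = s.arr a

theorem Exec.frame {w : ℕ} {ω : ℕ → Bool} {c : Cmd} {s s' : MemState} {t : ℕ}
    (h : Exec w ω c s t s') : c.Frame s s' := by
  induction h with
  | skip s => exact ⟨fun _ _ => rfl, fun _ _ => rfl⟩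
  | assign x e s =>
    exact ⟨fun y hy => Function.update_of_ne (by simpa [Cmd.wvars] using hy) _ _, fun _ _ => rfl⟩
  | store a i e s =>
    exact ⟨fun _ _ => rfl, fun b hb => Function.update_of_ne (by simpa [Cmd.warrs] using hb) _ _⟩
  | toss x s =>
    exact ⟨fun y hy => Function.update_of_ne (by simpa [Cmd.wvars] using hy) _ _, fun _ _ => rfl⟩
  | seq _ _ h1 h2 =>
    exact ⟨fun y hy => (h2.vars y (by simp_all [Cmd.wvars])).trans (h1.vars y (by simp_all [Cmd.wvars])),
      fun y hy => (h2.arr y (by simp_all [Cmd.warrs])).trans (h1.arr y (by simp_all [Cmd.warrs]))⟩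
  | ite_true _ _ h1 =>
    exact ⟨fun y hy => h1.vars y (by simp_all [Cmd.wvars]),
      fun y hy => h1.arr y (by simp_all [Cmd.warrs])⟩
  | ite_false _ _ h1 =>
    exact ⟨fun y hy => h1.vars y (by simp_all [Cmd.wvars]),
      fun y hy => h1.arr y (by simp_all [Cmd.warrs])⟩
  | loop_stop _ => exact ⟨fun _ _ => rfl, fun _ _ => rfl⟩
  | loop_step _ _ _ h1 h2 =>
    exact ⟨fun y hy => (h2.vars y hy).trans (h1.vars y (by simpa [Cmd.wvars] using hy)),
      fun y hy => (h2.arr y hy).trans (h1.arr y (by simpa [Cmd.warrs] using hy))⟩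

/-- Started in `s`, the program halts within time `T` in a memory that satisfies `Q`. -/
def Runs (w : ℕ) (ω : ℕ → Bool) (c : Cmd) (s : MemState) (T : ℕ) (Q : MemState → Prop) : Prop :=
  ∃ t s', Exec w ω c s t s' ∧ t ≤ T ∧ Q s'

namespace Runs

variable {w : ℕ} {ω : ℕ → Bool} {c d : Cmd} {s : MemState} {T U : ℕ} {Q P : MemState → Prop}

theorem mono (h : Runs w ω c s T Q) (hT : T ≤ U) (hQ : ∀ s', Q s' → P s') : Runs w ω c s U P := by
  obtain ⟨t, s', h, ht, hq⟩ := h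
  exact ⟨t, s', h, ht.trans hT, hQ s' hq⟩

theorem mono_time (h : Runs w ω c s T Q) (hT : T ≤ U) : Runs w ω c s U Q := h.mono hT fun _ => id

theorem with_frame (h : Runs w ω c s T Q) : Runs w ω c s T (fun s' => Q s' ∧ c.Frame s s') := by
  obtain ⟨t, s', h, ht, hq⟩ := h
  exact ⟨t, s', h, ht, hq, h.frame⟩

theorem skip (h : Q s) : Runs w ω .skip s 1 Q := ⟨1, s, .skip s, le_rfl, h⟩

theorem assign {x : ℕ} {e : Expr} (he : e.Fits w s) (h : Q (s.setVar x (e.val s))) :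
    Runs w ω (.assign x e) s (e.cost + 1) Q :=
  ⟨_, _, .assign x e s, le_rfl, by rw [he.eval_eq]; exact h⟩

theorem store {a : ℕ} {i e : Expr} (hi : i.Fits w s) (he : e.Fits w s)
    (h : Q (s.setArr a (i.val s) (e.val s))) :
    Runs w ω (.store a i e) s (i.cost + e.cost + 1) Q :=
  ⟨_, _, .store a i e s, le_rfl, by rw [he.eval_eq, hi.eval_eq]; exact h⟩

theorem toss {x : ℕ}
    (h : Q { s.setVar x (ω s.tossed).toNat with tossed := s.tossed + 1 }) :
    Runs w ω (.toss x) s 1 Q :=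
  ⟨_, _, .toss x s, le_rfl, h⟩

theorem seq (h : Runs w ω c s T (fun s' => Runs w ω d s' U Q)) : Runs w ω (.seq c d) s (T + U) Q := by
  obtain ⟨t, s', h, ht, u, s'', h', hu, hq⟩ := h
  exact ⟨t + u, s'', .seq h h', by omega, hq⟩

theorem ite {e : Expr} (he : e.Fits w s) (hc : e.val s ≠ 0 → Runs w ω c s T Q)
    (hd : e.val s = 0 → Runs w ω d s T Q) : Runs w ω (.ite e c d) s (e.cost + 1 + T) Q := by
  by_cases h0 : e.val s = 0
  · obtain ⟨t, s', h, ht, hq⟩ := hd h0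
    exact ⟨_, s', .ite_false (by rw [he.eval_eq, h0]) h, by omega, hq⟩
  · obtain ⟨t, s', h, ht, hq⟩ := hc h0
    exact ⟨_, s', .ite_true (by rw [he.eval_eq]; exact h0) h, by omega, hq⟩

end Runs

/-- `for x = 0, …, N - 1`, where `N` is a variable. -/
def Cmd.for (x N : ℕ) (c : Cmd) : Cmd :=
  .seq (.assign x (.const 0))
    (.loop (.op .lt (.var x) (.var N)) (.seq c (.assign x (.op .add (.var x) (.const 1)))))

@[simp] theorem Cmd.wvars_for (x N : ℕ) (c : Cmd) : (Cmd.for x N c).wvars = x :: (c.wvars ++ [x]) :=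
  rfl

@[simp] theorem Cmd.warrs_for (x N : ℕ) (c : Cmd) : (Cmd.for x N c).warrs = c.warrs ++ [] := rfl

/-- Induction on the number of remaining passes. A pass costs 8 beyond its body, 4 for the test and
4 for the increment; the final 6 pays for the initialization and the last test. The body receives
the frame back to the start of the loop, so that an invariant mentions only what the loop changes.
-/
theorem Runs.for {w : ℕ} {ω : ℕ → Bool} {x N : ℕ} {c : Cmd} {s : MemState} {T : ℕ}
    (I : ℕ → MemState → Prop) (n : ℕ) (hN : s.vars N = n) (hn : n < 2 ^ w)
    (hx : x ∉ c.wvars) (hNx : N ≠ x) (hNc : N ∉ c.wvars) (h0 : I 0 (s.setVar x 0))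
    (hstep : ∀ i < n, ∀ s', (Cmd.for x N c).Frame s s' → s'.vars x = i → I i s' →
      Runs w ω c s' T (fun s'' => I (i + 1) (s''.setVar x (i + 1)))) :
    Runs w ω (Cmd.for x N c) s (n * (T + 8) + 6)
      (fun s' => I n s' ∧ (Cmd.for x N c).Frame s s') := by
  have key : ∀ m i, i + m = n → ∀ s', (Cmd.for x N c).Frame s s' → s'.vars x = i → I i s' →
      Runs w ω (.loop (.op .lt (.var x) (.var N)) (.seq c (.assign x (.op .add (.var x) (.const 1)))))
        s' (m * (T + 8) + 4) (I n) := by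
    intro m
    induction m with
    | zero =>
      intro i hi s' hF hxi hI
      have hN' : s'.vars N = n := by
        rw [hF.vars N (by simp [Cmd.for, Cmd.wvars, hNc, hNx]), hN]
      refine ⟨_, s', Exec.loop_stop ?_, ?_, ?_⟩
      · simp only [Expr.eval, BinOp.eval, hxi, hN']
        rw [if_neg (by omega)]; simp
      · simp [Expr.cost]
      · rwa [← hi]
    | succ m ih =>
      intro i hi s' hF hxi hI
      have hN' : s'.vars N = n := by
        rw [hF.vars N (by simp [Cmd.for, Cmd.wvars, hNc, hNx]), hN]
      obtain ⟨t, s₁, h1, ht, hI1⟩ := hstep i (by omega) s' hF hxi hI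
      have hx1 : s₁.vars x = i := by rw [h1.frame.vars x hx, hxi]
      have h1' : Exec w ω (.seq c (.assign x (.op .add (.var x) (.const 1)))) s' (t + 4)
          (s₁.setVar x (i + 1)) := by
        refine .seq h1 ?_
        have hfit : (Expr.op .add (.var x) (.const 1)).Fits w s₁ := by
          simp only [Expr.Fits, Expr.val, BinOp.eval, hx1, true_and]
          omega
        have := Exec.assign (w := w) (ω := ω) x (.op .add (.var x) (.const 1)) s₁
        rw [hfit.eval_eq] at this
        simpa [Expr.val, BinOp.eval, hx1, Expr.cost, MemState.setVar] using this
      have hF1 : (Cmd.for x N c).Frame s (s₁.setVar x (i + 1)) := by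
        have := h1'.frame
        constructor
        · intro y hy
          rw [this.vars y (by simp_all [Cmd.for, Cmd.wvars]), hF.vars y hy]
        · intro y hy
          rw [this.arr y (by simp_all [Cmd.for, Cmd.warrs]), hF.arr y hy]
      obtain ⟨u, s₂, h2, hu, hI2⟩ := ih (i + 1) (by omega) _ hF1 (by simp) hI1
      refine ⟨_, s₂, .loop_step ?_ h1' h2, ?_, hI2⟩
      · simp only [Expr.eval, BinOp.eval, hxi, hN']
        rw [if_pos (by omega), Nat.mod_eq_of_lt (by omega)]; simp
      · simp only [Expr.cost]
        have : (m + 1) * (T + 8) = m * (T + 8) + (T + 8) := by ring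
        omega
  have hrun : Runs w ω (Cmd.for x N c) s (2 + (n * (T + 8) + 4)) (I n) := by
    refine .seq (.assign (by simp [Expr.Fits]) ?_)
    refine key n 0 (by omega) _ ?_ (by simp [Expr.val]) h0
    constructor
    · intro y hy
      simp only [Cmd.for, Cmd.wvars] at hy
      simp_all
    · intro y _; rfl
  exact hrun.with_frame.mono_time (by omega)

/-! ## The clustering program

Variables: `1` is the dimension `q`, `8` the number `t` of random vectors, `9` the number `n` of
points, `10` the number `m` of centers, and `11`, `12` are the strides of the array of points. The
random vectors are in the array `3`, the projections in the array `4`, and the distances to the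
closest center in the array `5`. -/

/-- Count the agreements of the current point with the current random vector. -/
def agreeLoop (a : ℕ) : Cmd :=
  .for 15 1 (.assign 16 (.op .add (.var 16) (.op .eq
    (.load a (.op .add (.op .mul (.var 13) (.var 11)) (.op .mul (.var 15) (.var 12))))
    (.load 3 (.op .add (.op .mul (.var 14) (.var 1)) (.var 15))))))

def projectPoint (a : ℕ) : Cmd :=
  .for 14 8 (.seq (.assign 16 (.const 0)) (.seq (agreeLoop a)
    (.store 4 (.op .add (.op .mul (.var 13) (.var 8)) (.var 14)) (.var 16))))

def projectAll (a : ℕ) : Cmd := .for 13 9 (projectPoint a)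

@[simp] theorem wvars_agreeLoop (a : ℕ) : (agreeLoop a).wvars = [15, 16, 15] := rfl
@[simp] theorem warrs_agreeLoop (a : ℕ) : (agreeLoop a).warrs = [] := rfl
@[simp] theorem wvars_projectPoint (a : ℕ) : (projectPoint a).wvars = [14, 16, 15, 16, 15, 14] := rfl
@[simp] theorem warrs_projectPoint (a : ℕ) : (projectPoint a).warrs = [4] := rfl
@[simp] theorem wvars_projectAll (a : ℕ) :
    (projectAll a).wvars = [13, 14, 16, 15, 16, 15, 14, 13] := rfl
@[simp] theorem warrs_projectAll (a : ℕ) : (projectAll a).warrs = [4] := rfl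

/-- The number of agreements of the vectors `x` and `y` among the first `n` coordinates. -/
def agreements (x y : ℕ → ℕ) (n : ℕ) : ℕ := ∑ m ∈ Finset.range n, if x m = y m then 1 else 0

@[simp] theorem agreements_zero (x y : ℕ → ℕ) : agreements x y 0 = 0 := rfl

theorem agreements_succ (x y : ℕ → ℕ) (n : ℕ) :
    agreements x y (n + 1) = agreements x y n + if x n = y n then 1 else 0 :=
  Finset.sum_range_succ _ _

theorem agreements_le (x y : ℕ → ℕ) (n : ℕ) : agreements x y n ≤ n := by
  induction n with
  | zero => simp
  | succ n ih => rw [agreements_succ]; split_ifs <;> omega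

theorem Nat.mul_add_lt_mul_of_lt {i j m n : ℕ} (hi : i < m) (hj : j < n) : i * n + j < m * n := by
  nlinarith [Nat.mul_le_mul_right n hi]

section

variable {w : ℕ} {ω : ℕ → Bool}

theorem runs_agreeLoop {a q u j su sm : ℕ} {s : MemState} (hq : s.vars 1 = q) (hu : s.vars 13 = u)
    (hj : s.vars 14 = j) (hsu : s.vars 11 = su) (hsm : s.vars 12 = sm) (h16 : s.vars 16 = 0)
    (hfit : u * su + q * sm < 2 ^ w) (hfit' : j * q + q < 2 ^ w) (hw : q + 1 < 2 ^ w) :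
    Runs w ω (agreeLoop a) s (q * 26 + 6) (fun s' =>
      s'.vars 16 = agreements (fun m => s.arr a (u * su + m * sm)) (fun m => s.arr 3 (j * q + m)) q ∧
      (agreeLoop a).Frame s s') := by
  refine Runs.for (T := 18) (fun i s' => s'.vars 16 =
    agreements (fun m => s.arr a (u * su + m * sm)) (fun m => s.arr 3 (j * q + m)) i) q hq (by omega)
    (by simp [Cmd.wvars]) (by simp) (by simp [Cmd.wvars]) (by simp [h16]) ?_
  intro i hi s' hF hxi hI
  have hle := agreements_le (fun m => s.arr a (u * su + m * sm)) (fun m => s.arr 3 (j * q + m)) i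
  have h1 : i * sm ≤ q * sm := Nat.mul_le_mul_right _ hi.le
  have hv : ∀ y, y ≠ 15 → y ≠ 16 → s'.vars y = s.vars y := fun y h1 h2 =>
    hF.vars y (by simp [Cmd.wvars, h1, h2])
  have ha : ∀ b, s'.arr b = s.arr b := fun b => hF.arr b (by simp [Cmd.warrs])
  refine (Runs.assign ?_ ?_).mono_time (U := 18) ?_
  · simp [Expr.Fits, Expr.val, BinOp.eval, ha, hv, hu, hsu, hsm, hj, hq, hxi, hI]
    split_ifs <;> omega
  · simp [Expr.val, BinOp.eval, ha, hv, hu, hsu, hsm, hj, hq, hxi, hI, agreements_succ]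
  · simp [Expr.cost]

/-- The clause about `x < u * t` serves the outer loop: the projections of the earlier points lie
there and must survive. -/
theorem runs_projectPoint {a q t u su sm : ℕ} {s : MemState} (hq : s.vars 1 = q)
    (ht : s.vars 8 = t) (hu : s.vars 13 = u) (hsu : s.vars 11 = su) (hsm : s.vars 12 = sm)
    (ha3 : a < 3)
    (hfit : u * su + q * sm < 2 ^ w) (htq : t * q < 2 ^ w) (hut : u * t + t < 2 ^ w)
    (hw : q + 1 < 2 ^ w) :
    Runs w ω (projectPoint a) s (t * (q * 26 + 30) + 6) (fun s' =>
      ((∀ j < t, s'.arr 4 (u * t + j) =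
          agreements (fun m => s.arr a (u * su + m * sm)) (fun m => s.arr 3 (j * q + m)) q) ∧
        ∀ x < u * t, s'.arr 4 x = s.arr 4 x) ∧
      (projectPoint a).Frame s s') := by
  refine (Runs.for (T := q * 26 + 22) (fun i s' =>
    (∀ j < i, s'.arr 4 (u * t + j) =
          agreements (fun m => s.arr a (u * su + m * sm)) (fun m => s.arr 3 (j * q + m)) q) ∧
        ∀ x < u * t, s'.arr 4 x = s.arr 4 x) t ht (by omega)
    (by simp [Cmd.wvars]) (by simp) (by simp [Cmd.wvars]) (by simp) ?_).mono_time (by ring_nf; rfl)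
  intro j hj s' hF hxi ⟨hI, hI'⟩
  have hjq : j * q + q ≤ t * q := by nlinarith
  have hv : ∀ y, y < 14 → s'.vars y = s.vars y := fun y h1 =>
    hF.vars y (by simp [Cmd.wvars]; omega)
  have harr : ∀ b, b ≠ 4 → s'.arr b = s.arr b := fun b hb => hF.arr b (by simp [Cmd.warrs, hb])
  refine Runs.mono_time (Runs.seq (Runs.assign (by simp [Expr.Fits]) (Runs.seq
    (U := 8) (((runs_agreeLoop (q := q) (u := u) (j := j) (su := su) (sm := sm) (by simp [hv, hq])
      (by simp [hv, hu]) (by simp [hxi]) (by simp [hv, hsu]) (by simp [hv, hsm])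
      (by simp [Expr.val]) hfit (by omega) hw)).mono le_rfl ?_)))) ?_
  · rintro s'' ⟨h16, hF'⟩
    have hv' : ∀ y, y < 14 → s''.vars y = s.vars y := fun y hy => by
      rw [hF'.vars y (by simp; omega), MemState.vars_setVar, if_neg (by omega), hv y hy]
    have h14 : s''.vars 14 = j := by rw [hF'.vars 14 (by simp)]; simp [hxi]
    have h4 : s''.arr 4 = s'.arr 4 := by rw [hF'.arr 4 (by simp)]; simp
    have ha : a ≠ 4 := by omega
    simp only [MemState.arr_setVar, harr a ha, harr 3 (by decide)] at h16
    refine (Runs.store ?_ ?_ ?_).mono_time (U := 8) ?_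
    · simp [Expr.Fits, Expr.val, BinOp.eval, hv', hu, ht, h14]
      omega
    · simp [Expr.Fits]
    · constructor
      · intro i hi
        simp only [Expr.val, BinOp.eval, hv', hu, ht, h14, h16, MemState.arr_setVar,
          MemState.arr_setArr, true_and, Nat.reduceLT, h4]
        by_cases hij : i = j
        · simp [hij]
        · rw [if_neg (by omega), hI i (by omega)]
      · intro x hx
        simp only [Expr.val, BinOp.eval, hv', hu, ht, h14, MemState.arr_setVar,
          MemState.arr_setArr, true_and, Nat.reduceLT, h4]
        rw [if_neg (by omega), hI' x hx]
    · simp [Expr.cost]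
  · simp [Expr.cost]; omega

theorem runs_projectAll {a n q t su sm : ℕ} {s : MemState} (hq : s.vars 1 = q)
    (ht : s.vars 8 = t) (hn : s.vars 9 = n) (hsu : s.vars 11 = su) (hsm : s.vars 12 = sm)
    (ha3 : a < 3) (hfit : n * su + q * sm < 2 ^ w) (htq : t * q < 2 ^ w) (hnt : n * t + t < 2 ^ w)
    (hw : q + 1 < 2 ^ w) (hnw : n < 2 ^ w) :
    Runs w ω (projectAll a) s (n * (t * (q * 26 + 30) + 14) + 6) (fun s' =>
      (∀ u < n, ∀ j < t, s'.arr 4 (u * t + j) =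
          agreements (fun m => s.arr a (u * su + m * sm)) (fun m => s.arr 3 (j * q + m)) q) ∧
      (projectAll a).Frame s s') := by
  refine (Runs.for (T := t * (q * 26 + 30) + 6) (fun i s' => ∀ u < i, ∀ j < t, s'.arr 4 (u * t + j) =
      agreements (fun m => s.arr a (u * su + m * sm)) (fun m => s.arr 3 (j * q + m)) q) n hn hnw
    (by simp) (by simp) (by simp) (by simp) ?_)
  intro u hu s' hF hxi hI
  have h1 : u * su ≤ n * su := Nat.mul_le_mul_right _ hu.le
  have h2 : u * t ≤ n * t := Nat.mul_le_mul_right _ hu.le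
  have hv : ∀ y, y < 13 → s'.vars y = s.vars y := fun y h1 =>
    hF.vars y (by simp; omega)
  have harr : ∀ b, b ≠ 4 → s'.arr b = s.arr b := fun b hb => hF.arr b (by simp [hb])
  refine (runs_projectPoint (q := q) (t := t) (u := u) (su := su) (sm := sm) (by simp [hv, hq])
    (by simp [hv, ht]) hxi (by simp [hv, hsu]) (by simp [hv, hsm]) ha3 (by omega) htq (by omega)
    hw).mono le_rfl ?_
  rintro s'' ⟨⟨h, h'⟩, -⟩ u' hu' j hj
  rw [harr a (by omega), harr 3 (by decide)] at h
  rw [MemState.arr_setVar]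
  by_cases huu : u' = u
  · subst huu; exact h j hj
  · rw [h' _ (Nat.mul_add_lt_mul_of_lt (by omega) hj), hI u' (by omega) j hj]

end

/-! ### Farthest-first traversal -/

/-- The square of the difference, written with truncated subtraction. -/
def sqDiff (a b : ℕ) : ℕ := (a - b) * (a - b) + (b - a) * (b - a)

theorem sqDiff_le {a b q : ℕ} (ha : a ≤ q) (hb : b ≤ q) : sqDiff a b ≤ q * q := by
  unfold sqDiff
  rcases le_total a b with h | h
  · rw [Nat.sub_eq_zero_of_le h, zero_mul, zero_add]; exact Nat.mul_le_mul (by omega) (by omega)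
  · rw [Nat.sub_eq_zero_of_le h, mul_zero, add_zero]; exact Nat.mul_le_mul (by omega) (by omega)

/-- The squared Euclidean distance between the points `u` and `v` among the first `n` of the `t`
coordinates in the array `Y`. -/
def sqDist (Y : ℕ → ℕ) (t n u v : ℕ) : ℕ :=
  ∑ j ∈ Finset.range n, sqDiff (Y (u * t + j)) (Y (v * t + j))

theorem sqDist_succ (Y : ℕ → ℕ) (t n u v : ℕ) :
    sqDist Y t (n + 1) u v = sqDist Y t n u v + sqDiff (Y (u * t + n)) (Y (v * t + n)) :=
  Finset.sum_range_succ _ _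

theorem sqDist_le {Y : ℕ → ℕ} {t n u v q : ℕ} (hu : ∀ j < n, Y (u * t + j) ≤ q)
    (hv : ∀ j < n, Y (v * t + j) ≤ q) : sqDist Y t n u v ≤ n * (q * q) := by
  refine (Finset.sum_le_card_nsmul _ _ (q * q) fun j hj => ?_).trans (by simp)
  exact sqDiff_le (hu j (Finset.mem_range.1 hj)) (hv j (Finset.mem_range.1 hj))

/-- Compute the distance from the point `13` to the point `19`. -/
def distLoop : Cmd :=
  .for 14 8 (.assign 16 (.op .add (.var 16) (.op .add
    (.op .mul
      (.op .sub (.load 4 (.op .add (.op .mul (.var 13) (.var 8)) (.var 14)))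
        (.load 4 (.op .add (.op .mul (.var 19) (.var 8)) (.var 14))))
      (.op .sub (.load 4 (.op .add (.op .mul (.var 13) (.var 8)) (.var 14)))
        (.load 4 (.op .add (.op .mul (.var 19) (.var 8)) (.var 14)))))
    (.op .mul
      (.op .sub (.load 4 (.op .add (.op .mul (.var 19) (.var 8)) (.var 14)))
        (.load 4 (.op .add (.op .mul (.var 13) (.var 8)) (.var 14))))
      (.op .sub (.load 4 (.op .add (.op .mul (.var 19) (.var 8)) (.var 14)))
        (.load 4 (.op .add (.op .mul (.var 13) (.var 8)) (.var 14))))))))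

/-- Update the assignment of the point `13` and the farthest point `17`. -/
def updatePoint (asg : ℕ) : Cmd :=
  .seq
    (.ite (.op .add (.op .eq (.var 18) (.const 0)) (.op .lt (.var 16) (.load 5 (.var 13))))
      (.seq (.store 5 (.var 13) (.var 16)) (.store asg (.var 13) (.var 18))) .skip)
    (.ite (.op .lt (.var 20) (.load 5 (.var 13)))
      (.seq (.assign 20 (.load 5 (.var 13))) (.assign 17 (.var 13))) .skip)

def updateAll (asg : ℕ) : Cmd :=
  .for 13 9 (.seq (.assign 16 (.const 0)) (.seq distLoop (updatePoint asg)))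

def farthestFirst (cen asg : ℕ) : Cmd :=
  .seq (.assign 17 (.const 0)) (.for 18 10 (.seq (.store cen (.var 18) (.var 17))
    (.seq (.assign 19 (.var 17)) (.seq (.assign 20 (.const 0)) (updateAll asg)))))

@[simp] theorem wvars_distLoop : distLoop.wvars = [14, 16, 14] := rfl
@[simp] theorem warrs_distLoop : distLoop.warrs = [] := rfl
@[simp] theorem wvars_updatePoint (asg : ℕ) : (updatePoint asg).wvars = [20, 17] := rfl
@[simp] theorem warrs_updatePoint (asg : ℕ) : (updatePoint asg).warrs = [5, asg] := rfl
@[simp] theorem wvars_updateAll (asg : ℕ) :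
    (updateAll asg).wvars = [13, 16, 14, 16, 14, 20, 17, 13] := rfl
@[simp] theorem warrs_updateAll (asg : ℕ) : (updateAll asg).warrs = [5, asg] := rfl
@[simp] theorem wvars_farthestFirst (cen asg : ℕ) :
    (farthestFirst cen asg).wvars = [17, 18, 19, 20, 13, 16, 14, 16, 14, 20, 17, 13, 18] := rfl
@[simp] theorem warrs_farthestFirst (cen asg : ℕ) :
    (farthestFirst cen asg).warrs = [cen, 5, asg] := rfl

/-- The first `s` steps of farthest-first traversal of `n` points with distance `d` have chosen the
centers `cen`, the assignment `asg` to the closest of them with distances `near`, and the farthest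
point `far`. -/
structure FarthestFirst (d : ℕ → ℕ → ℕ) (n s far : ℕ) (cen near asg : ℕ → ℕ) : Prop where
  far_lt : far < n
  cen_lt : ∀ a < s, cen a < n
  asg_lt : 0 < s → ∀ u < n, asg u < s
  near_eq : 0 < s → ∀ u < n, near u = d u (cen (asg u))
  near_le : ∀ u < n, ∀ a < s, near u ≤ d u (cen a)
  near_le_far : 0 < s → ∀ u < n, near u ≤ near far
  near_le_cen : ∀ u < n, ∀ b < s, ∀ a < b, near u ≤ d (cen b) (cen a)

/-- The point of the step is `near_le_cen` for the new center. Being the farthest point, it is at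
least `near far` away from every older center, which dominates all `near u`; and `near` never
increases once a center exists. Neither symmetry nor the triangle inequality is needed for `d`. -/
theorem FarthestFirst.step {d : ℕ → ℕ → ℕ} {n s far far' : ℕ} {cen near asg cen' near' asg' : ℕ → ℕ}
    (h : FarthestFirst d n s far cen near asg) (hfar : far' < n)
    (hfar' : ∀ u < n, near' u ≤ near' far') (hcen : ∀ a < s, cen' a = cen a) (hcen' : cen' s = far)
    (hnear : ∀ u < n, near' u = if s = 0 ∨ d u far < near u then d u far else near u)
    (hasg : ∀ u < n, asg' u = if s = 0 ∨ d u far < near u then s else asg u) :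
    FarthestFirst d n (s + 1) far' cen' near' asg' := by
  have hle : 0 < s → ∀ u < n, near' u ≤ near u := fun hs u hu => by
    rw [hnear u hu]; split_ifs <;> omega
  refine ⟨hfar, fun a ha => ?_, fun _ u hu => ?_, fun _ u hu => ?_, fun u hu a ha => ?_,
    fun _ => hfar', fun u hu b hb a hab => ?_⟩
  · rcases Nat.lt_succ_iff_lt_or_eq.1 ha with ha | rfl
    · rw [hcen a ha]; exact h.cen_lt a ha
    · rw [hcen']; exact h.far_lt
  · rw [hasg u hu]
    split_ifs with h0
    · omega
    · have := h.asg_lt (by omega) u hu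
      omega
  · rw [hnear u hu, hasg u hu]
    split_ifs with h0
    · rw [hcen']
    · rw [hcen _ (h.asg_lt (by omega) u hu)]
      exact h.near_eq (by omega) u hu
  · rcases Nat.lt_succ_iff_lt_or_eq.1 ha with ha | rfl
    · rw [hcen a ha]
      exact (hle (by omega) u hu).trans (h.near_le u hu a ha)
    · rw [hcen', hnear u hu]
      split_ifs <;> omega
  · rcases Nat.lt_succ_iff_lt_or_eq.1 hb with hb | rfl
    · rw [hcen b hb, hcen a (by omega)]
      exact (hle (by omega) u hu).trans (h.near_le_cen u hu b hb a hab)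
    · rw [hcen', hcen a hab]
      exact (hle (by omega) u hu).trans
        ((h.near_le_far (by omega) u hu).trans (h.near_le far h.far_lt a hab))

section

variable {w : ℕ} {ω : ℕ → Bool}

theorem runs_distLoop {t u c q : ℕ} {s : MemState} (ht : s.vars 8 = t) (hu : s.vars 13 = u)
    (hc : s.vars 19 = c) (h16 : s.vars 16 = 0) (hut : u * t + t < 2 ^ w) (hct : c * t + t < 2 ^ w)
    (hYu : ∀ j < t, s.arr 4 (u * t + j) ≤ q) (hYc : ∀ j < t, s.arr 4 (c * t + j) ≤ q)
    (htq : t * (q * q) < 2 ^ w) (hqw : q < 2 ^ w) :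
    Runs w ω distLoop s (t * 70 + 6) (fun s' =>
      s'.vars 16 = sqDist (s.arr 4) t t u c ∧ distLoop.Frame s s') := by
  refine Runs.for (T := 62) (fun i s' => s'.vars 16 = sqDist (s.arr 4) t i u c) t ht (by omega)
    (by simp [Cmd.wvars]) (by simp) (by simp [Cmd.wvars]) (by simp [h16, sqDist]) ?_
  intro i hi s' hF hxi hI
  -- The overflow bound must cover the summand that is about to be added, hence `i + 1`.
  have hle := sqDist_le (n := i + 1) (fun j hj => hYu j (by omega)) (fun j hj => hYc j (by omega))
  have hmono : (i + 1) * (q * q) ≤ t * (q * q) := Nat.mul_le_mul_right _ hi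
  rw [sqDist_succ] at hle
  have hv : ∀ y, y ≠ 14 → y ≠ 16 → s'.vars y = s.vars y := fun y h1 h2 =>
    hF.vars y (by simp [Cmd.wvars, h1, h2])
  have ha : ∀ b, s'.arr b = s.arr b := fun b => hF.arr b (by simp [Cmd.warrs])
  have hYui := hYu i hi
  have hYci := hYc i hi
  unfold sqDiff at hle
  refine (Runs.assign ?_ ?_).mono_time (U := 62) ?_
  · simp [Expr.Fits, Expr.val, BinOp.eval, ha, hv, hu, hc, ht, hxi, hI]
    omega
  · simp [Expr.val, BinOp.eval, ha, hv, hu, hc, ht, hxi, hI, sqDist_succ, sqDiff]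
  · simp [Expr.cost]

end

theorem BinOp.eval_lt_le_one (a b : ℕ) : BinOp.lt.eval a b ≤ 1 := by
  simp only [BinOp.eval]; split_ifs <;> simp

theorem BinOp.eval_eq_le_one (a b : ℕ) : BinOp.eq.eval a b ≤ 1 := by
  simp only [BinOp.eval]; split_ifs <;> simp

section

variable {w : ℕ} {ω : ℕ → Bool}

/-- The alternative `si = 0` forces an overwrite in the first round, when array `5` may still hold
the distances of a previous clustering. -/
theorem runs_updatePoint {asg d u si best far : ℕ} {s : MemState}
    (h16 : s.vars 16 = d) (hu : s.vars 13 = u) (hsi : s.vars 18 = si) (hb : s.vars 20 = best)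
    (hf : s.vars 17 = far) (hasg : asg ≠ 5) (hw : 2 < 2 ^ w) :
    Runs w ω (updatePoint asg) s 30 (fun s' =>
      (∀ x, s'.arr 5 x = if x = u ∧ (si = 0 ∨ d < s.arr 5 u) then d else s.arr 5 x) ∧
      (∀ x, s'.arr asg x = if x = u ∧ (si = 0 ∨ d < s.arr 5 u) then si else s.arr asg x) ∧
      (s'.vars 20, s'.vars 17) =
        if best < s'.arr 5 u then (s'.arr 5 u, u) else (best, far)) := by
  have hasg' : 5 ≠ asg := hasg.symm
  refine Runs.mono_time (Runs.seq (T := 15) (U := 12) ?_) (by norm_num)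
  -- Both outcomes of the first conditional lead to a memory of this form, so the second conditional
  -- is analyzed once.
  have second : ∀ s' : MemState, s'.vars = s.vars →
      (∀ x, s'.arr 5 x = if x = u ∧ (si = 0 ∨ d < s.arr 5 u) then d else s.arr 5 x) →
      (∀ x, s'.arr asg x = if x = u ∧ (si = 0 ∨ d < s.arr 5 u) then si else s.arr asg x) →
      Runs w ω (.ite (.op .lt (.var 20) (.load 5 (.var 13)))
        (.seq (.assign 20 (.load 5 (.var 13))) (.assign 17 (.var 13))) .skip) s' 12 (fun s' =>
      (∀ x, s'.arr 5 x = if x = u ∧ (si = 0 ∨ d < s.arr 5 u) then d else s.arr 5 x) ∧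
      (∀ x, s'.arr asg x = if x = u ∧ (si = 0 ∨ d < s.arr 5 u) then si else s.arr asg x) ∧
      (s'.vars 20, s'.vars 17) =
        if best < s'.arr 5 u then (s'.arr 5 u, u) else (best, far)) := by
    intro s' hv h5 hA
    refine (Runs.ite (T := 5) ?_ (fun h => ?_) (fun h => ?_)).mono_time (by simp [Expr.cost])
    · exact ⟨trivial, trivial, (BinOp.eval_lt_le_one _ _).trans_lt (by omega)⟩
    · have h' : best < s'.arr 5 u := by
        by_contra h0
        simp [Expr.val, BinOp.eval, hv, hb, hu] at h
        omega
      refine (Runs.seq (Runs.assign (by simp [Expr.Fits])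
        (Runs.assign (by simp [Expr.Fits]) ⟨?_, ?_, ?_⟩))).mono_time (by simp [Expr.cost])
      · simpa using h5
      · simpa using hA
      · simp [Expr.val, hv, hu, h']
    · have h' : ¬ best < s'.arr 5 u := by
        intro h0
        simp [Expr.val, BinOp.eval, hv, hb, hu] at h
        omega
      refine (Runs.skip ⟨h5, hA, ?_⟩).mono_time (by norm_num)
      simp [hv, hb, hf, h']
  refine (Runs.ite (T := 6) ?_ (fun h => ?_) (fun h => ?_)).mono_time (U := 15) ?_
  · have h1 := BinOp.eval_eq_le_one (s.vars 18) 0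
    have h2 := BinOp.eval_lt_le_one (s.vars 16) (s.arr 5 (s.vars 13))
    exact ⟨⟨trivial, Nat.two_pow_pos w, by simpa [Expr.val] using h1.trans_lt (by omega)⟩,
      ⟨trivial, trivial, h2.trans_lt (by omega)⟩, (Nat.add_le_add h1 h2).trans_lt (by omega)⟩
  · have h' : si = 0 ∨ d < s.arr 5 u := by
      by_contra h0
      simp [Expr.val, BinOp.eval, h16, hu, hsi] at h
      omega
    refine (Runs.seq (Runs.store (by simp [Expr.Fits]) (by simp [Expr.Fits])
        (Runs.store (by simp [Expr.Fits]) (by simp [Expr.Fits]) ?_))).mono_time (by simp [Expr.cost])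
    refine second _ rfl (fun x => ?_) (fun x => ?_)
    · simp [Expr.val, h16, hu, h', hasg']
    · simp [Expr.val, hsi, hu, h', hasg]
  · have h' : ¬ (si = 0 ∨ d < s.arr 5 u) := by
      intro h0
      simp [Expr.val, BinOp.eval, h16, hu, hsi] at h
      omega
    refine (Runs.skip (second _ rfl (fun x => ?_) (fun x => ?_))).mono_time (by norm_num)
    · simp [h']
    · simp [h']
  · simp [Expr.cost]

theorem runs_updateAll {asg n t c si q : ℕ} {s : MemState} (ht : s.vars 8 = t) (hn : s.vars 9 = n)
    (hc : s.vars 19 = c) (hsi : s.vars 18 = si) (hb : s.vars 20 = 0) (hf : s.vars 17 = c)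
    (hasg : 5 < asg) (hcn : c < n) (hw : 2 < 2 ^ w) (hnt : n * t + t < 2 ^ w) (hnw : n < 2 ^ w)
    (hY : ∀ u < n, ∀ j < t, s.arr 4 (u * t + j) ≤ q)
    (htq : t * (q * q) < 2 ^ w) (hqw : q < 2 ^ w) :
    Runs w ω (updateAll asg) s (n * (t * 70 + 50) + 6) (fun s' =>
      (s'.vars 17 < n ∧ (∀ u < n, s'.arr 5 u ≤ s'.arr 5 (s'.vars 17)) ∧
      (∀ u < n, s'.arr 5 u = if si = 0 ∨ sqDist (s.arr 4) t t u c < s.arr 5 u then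
        sqDist (s.arr 4) t t u c else s.arr 5 u) ∧
      (∀ u < n, s'.arr asg u = if si = 0 ∨ sqDist (s.arr 4) t t u c < s.arr 5 u then
        si else s.arr asg u)) ∧ (updateAll asg).Frame s s') := by
  set d : ℕ → ℕ := fun u => sqDist (s.arr 4) t t u c with hd
  set nn : ℕ → ℕ := fun u => if si = 0 ∨ d u < s.arr 5 u then d u else s.arr 5 u with hnn
  -- The running maximum `20` starts at 0 and is replaced only by strictly larger values. While it
  -- is 0, variable `17` may still be the old center; all distances seen so far are then 0, and any
  -- point is farthest.
  refine (Runs.for (T := t * 70 + 38) (fun i s' =>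
    (∀ x, s'.arr 5 x = if x < i then nn x else s.arr 5 x) ∧
    (∀ x, s'.arr asg x = if x < i ∧ (si = 0 ∨ d x < s.arr 5 x) then si else s.arr asg x) ∧
    s'.vars 17 < n ∧ (s'.vars 20 = 0 ∨ s'.vars 17 < i ∧ s'.vars 20 ≤ nn (s'.vars 17)) ∧
    ∀ u < i, nn u ≤ s'.vars 20) n hn hnw (by simp [Cmd.wvars]) (by simp) (by simp [Cmd.wvars])
    (by simp [hb, hf, hcn]) ?_).mono (Nat.add_le_add_right (Nat.mul_le_mul_left _ (by omega)) _) ?_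
  · intro u hu s' hF hxi ⟨h5, hA, hfar, hbest, hmax⟩
    have hut : u * t ≤ n * t := Nat.mul_le_mul_right _ hu.le
    have hct : c * t ≤ n * t := Nat.mul_le_mul_right _ hcn.le
    have h8 : s'.vars 8 = t := by rw [hF.vars 8 (by simp [Cmd.wvars]), ht]
    have h19 : s'.vars 19 = c := by rw [hF.vars 19 (by simp [Cmd.wvars]), hc]
    have h18 : s'.vars 18 = si := by rw [hF.vars 18 (by simp [Cmd.wvars]), hsi]
    have h4 : s'.arr 4 = s.arr 4 := hF.arr 4 (by simp [Cmd.warrs]; omega)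
    refine (Runs.seq (Runs.assign (by simp [Expr.Fits]) (Runs.seq (U := 30) ((runs_distLoop (t := t)
      (u := u) (c := c) (q := q) (by simp [h8]) (by simp [hxi]) (by simp [h19]) (by simp [Expr.val])
      (by omega) (by omega) (by simpa [h4] using hY u hu) (by simpa [h4] using hY c hcn) htq
      hqw).mono le_rfl ?_)))).mono_time (by simp [Expr.cost]; omega)
    rintro s₁ ⟨h16, hF₁⟩
    have hv₁ : ∀ y, y ≠ 14 → y ≠ 16 → s₁.vars y = s'.vars y := fun y h1 h2 => by
      rw [hF₁.vars y (by simp [h1, h2])]; simp [h2]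
    have ha₁ : s₁.arr = s'.arr := by
      funext b
      rw [hF₁.arr b (by simp)]; simp
    simp only [MemState.arr_setVar, h4] at h16
    refine (runs_updatePoint (d := d u) (u := u) (si := si) (best := s'.vars 20) (far := s'.vars 17)
      h16 (by simp [hv₁, hxi]) (by simp [hv₁, h18]) (by simp [hv₁]) (by simp [hv₁]) (by omega)
      hw).mono le_rfl ?_
    rintro s₂ ⟨h5₂, hA₂, hbf⟩
    rw [ha₁] at h5₂ hA₂
    have h5u : s'.arr 5 u = s.arr 5 u := by rw [h5, if_neg (by omega)]
    have hnu : s₂.arr 5 u = nn u := by simp [h5₂, h5u, hnn]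
    rw [hnu] at hbf
    refine ⟨fun x => ?_, fun x => ?_, ?_⟩
    · rw [MemState.arr_setVar, h5₂]
      rcases eq_or_ne x u with rfl | hx
      · simp [h5u, hnn]
      · rw [if_neg (by tauto), h5]
        exact if_congr (by omega) rfl rfl
    · rw [MemState.arr_setVar, hA₂]
      rcases eq_or_ne x u with rfl | hx
      · simp [h5u, hA]
      · rw [if_neg (by tauto), hA]
        exact if_congr (and_congr_left' (by omega)) rfl rfl
    · simp only [MemState.vars_setVar, Nat.reduceEqDiff, if_false]
      split_ifs at hbf with hlt <;> obtain ⟨h20, h17⟩ := Prod.mk.inj hbf <;> rw [h20, h17]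
      · refine ⟨hu, Or.inr ⟨by omega, le_rfl⟩, fun v hv => ?_⟩
        rcases Nat.lt_succ_iff_lt_or_eq.1 hv with hv | rfl
        · exact (hmax v hv).trans hlt.le
        · exact le_rfl
      · refine ⟨hfar, hbest.imp_right fun h => ⟨by omega, h.2⟩, fun v hv => ?_⟩
        rcases Nat.lt_succ_iff_lt_or_eq.1 hv with hv | rfl
        · exact hmax v hv
        · exact not_lt.1 hlt
  · rintro s' ⟨⟨h5, hA, hfar, hbest, hmax⟩, hF⟩
    have h5' : ∀ u < n, s'.arr 5 u = nn u := fun u hu => by rw [h5, if_pos hu]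
    refine ⟨⟨hfar, fun u hu => ?_, h5', fun u hu => by rw [hA]; simp [hu, hd]⟩, hF⟩
    rw [h5' u hu, h5' _ hfar]
    rcases hbest with h0 | h0
    · have := hmax u hu
      omega
    · exact (hmax u hu).trans h0.2

theorem runs_farthestFirst {cen asg n m t q : ℕ} {s : MemState} (ht : s.vars 8 = t)
    (hn : s.vars 9 = n) (hm : s.vars 10 = m) (hcen : 5 < cen) (hasg : 5 < asg) (hne : cen ≠ asg)
    (hn0 : 0 < n) (hw : 2 < 2 ^ w) (hnt : n * t + t < 2 ^ w) (hnw : n < 2 ^ w) (hmw : m < 2 ^ w)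
    (hY : ∀ u < n, ∀ j < t, s.arr 4 (u * t + j) ≤ q)
    (htq : t * (q * q) < 2 ^ w) (hqw : q < 2 ^ w) :
    Runs w ω (farthestFirst cen asg) s (m * (n * (t * 70 + 50) + 30) + 10) (fun s' =>
      ∃ far near, FarthestFirst (sqDist (s.arr 4) t t) n m far (s'.arr cen) near (s'.arr asg)) := by
  refine (Runs.seq (Runs.assign (by simp [Expr.Fits]) (Runs.for (T := n * (t * 70 + 50) + 20)
    (fun i s' => FarthestFirst (sqDist (s.arr 4) t t) n i (s'.vars 17) (s'.arr cen) (s'.arr 5)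
      (s'.arr asg)) m (by simp [hm]) hmw (by simp [Cmd.wvars]) (by simp) (by simp [Cmd.wvars]) ?_
      ?_))).mono (by simp [Expr.cost]; nlinarith) (fun s' h => ⟨_, _, h.1⟩)
  -- Before the first center only `far_lt` has content; the traversal starts at the point 0.
  · exact ⟨by simpa [Expr.val] using hn0, by simp, by simp, by simp, by simp, by simp, by simp⟩
  · intro i hi s' hF hxi hI
    have h8 : s'.vars 8 = t := by rw [hF.vars 8 (by simp [Cmd.wvars])]; simp [ht]
    have h9 : s'.vars 9 = n := by rw [hF.vars 9 (by simp [Cmd.wvars])]; simp [hn]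
    have h4 : s'.arr 4 = s.arr 4 := by rw [hF.arr 4 (by simp [Cmd.warrs]; omega)]; simp
    refine (Runs.seq (Runs.store (by simp [Expr.Fits]) (by simp [Expr.Fits]) (Runs.seq (Runs.assign
      (by simp [Expr.Fits]) (Runs.seq (Runs.assign (by simp [Expr.Fits]) ((runs_updateAll (n := n)
      (t := t) (q := q) (c := s'.vars 17) (si := i) (by simp [h8]) (by simp [h9])
      (by simp [Expr.val]) (by simp [hxi]) (by simp [Expr.val]) (by simp) hasg hI.far_lt hw hnt hnw
      ?_ htq hqw).mono le_rfl ?_))))))).mono_time (by simp [Expr.cost]; omega)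
    · intro u hu j hj
      have h4c : 4 ≠ cen := by omega
      simpa [h4c, h4] using hY u hu j hj
    · rintro s₂ ⟨⟨hfar, hmax, hnear, hA⟩, hF₂⟩
      have h4c : 4 ≠ cen := by omega
      have h5c : 5 ≠ cen := by omega
      have hc₂ : s₂.arr cen = _ := hF₂.arr cen (by simp; omega)
      have hs4 : ((s'.setArr cen (Expr.val s' (.var 18)) (Expr.val s' (.var 17))).arr 4) = s'.arr 4 := by
        funext x; simp [h4c]
      simp only [MemState.arr_setVar, hs4, h4, MemState.arr_setArr, h5c, hne.symm, false_and,
        if_false] at hnear hA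
      refine hI.step (far' := s₂.vars 17) (by simpa using hfar) (by simpa using hmax) ?_ ?_
        (by simpa using hnear) (by simpa using hA)
      · intro a ha
        have : a ≠ i := ha.ne
        simp [hc₂, Expr.val, hxi, this]
      · simp [hc₂, Expr.val, hxi]

end

/-- Passes from the distances in array `4` to `projDist`, and from the stored random bits to the
coins. -/
theorem FarthestFirst.congr {d d' : ℕ → ℕ → ℕ} {n s far : ℕ} {cen near asg : ℕ → ℕ}
    (h : FarthestFirst d n s far cen near asg) (hd : ∀ u < n, ∀ v < n, d u v = d' u v) :
    FarthestFirst d' n s far cen near asg :=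
  ⟨h.far_lt, h.cen_lt, h.asg_lt,
    fun hs u hu => (h.near_eq hs u hu).trans (hd _ hu _ (h.cen_lt _ (h.asg_lt hs u hu))),
    fun u hu a ha => (h.near_le u hu a ha).trans_eq (hd _ hu _ (h.cen_lt a ha)),
    h.near_le_far,
    fun u hu b hb a hab => (h.near_le_cen u hu b hb a hab).trans_eq
      (hd _ (h.cen_lt b hb) _ (h.cen_lt a (hab.trans hb)))⟩

/-! ### The complete algorithm -/

/-- The squared distance of the projections of the points `u` and `v` with coordinates `X`: the
`j`-th coordinate of the projection counts the agreements with the `j`-th vector of `R`. -/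
def projDist (X : ℕ → ℕ → ℕ) (R : ℕ → ℕ) (q t u v : ℕ) : ℕ :=
  ∑ j ∈ Finset.range t, sqDiff (agreements (X u) (fun m => R (j * q + m)) q)
    (agreements (X v) (fun m => R (j * q + m)) q)

/-- Cluster the points in the array `a`: their number, the number of centers and the strides are
read from `N`, `M`, `e₁` and `e₂`, the centers and the assignment go to the arrays `cen`, `asg`. -/
def clusterPoints (a cen asg N M : ℕ) (e₁ e₂ : Expr) : Cmd :=
  .seq (.assign 9 (.var N)) (.seq (.assign 10 (.var M)) (.seq (.assign 11 e₁) (.seq (.assign 12 e₂)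
    (.seq (projectAll a) (farthestFirst cen asg)))))

/-- Compute the number `8` of random vectors: `C e² log₂ (p + r - 1) + 1`. -/
def computeLength (C : ℕ) : Cmd :=
  .seq (.assign 6 (.op .sub (.op .add (.var 0) (.var 2)) (.const 1)))
    (.seq (.loop (.op .lt (.const 1) (.var 6))
        (.seq (.assign 6 (.op .div (.var 6) (.const 2))) (.assign 8 (.op .add (.var 8) (.const 1)))))
      (.seq (.assign 8 (.op .add (.op .mul (.op .mul (.op .mul (.const C) (.var 5)) (.var 5)) (.var 8))
          (.const 1)))
        (.assign 7 (.op .mul (.var 8) (.var 1)))))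

def tossVectors : Cmd := .for 13 7 (.seq (.toss 21) (.store 3 (.var 13) (.var 21)))

/-- Fill the array `a` of row length `M`; `c` computes the entry `e`. -/
def fillArray (a N M : ℕ) (c : Cmd) (e : Expr) : Cmd :=
  .for 13 N (.for 14 M (.seq c (.store a (.op .add (.op .mul (.var 13) (.var M)) (.var 14)) e)))

/-- Compute the inner product of the current pair of centers. -/
def innerProduct : Cmd :=
  .seq (.assign 16 (.const 0)) (.for 15 1 (.assign 16 (.op .add (.var 16) (.op .mul
    (.load 0 (.op .add (.op .mul (.load 6 (.var 13)) (.var 1)) (.var 15)))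
    (.load 1 (.op .add (.op .mul (.var 15) (.var 2)) (.load 8 (.var 14))))))))

def multiplyCenters : Cmd := fillArray 10 3 4 innerProduct (.var 16)

def writeOutput : Cmd :=
  fillArray 2 0 2 .skip (.load 10 (.op .add (.op .mul (.load 7 (.var 13)) (.var 4)) (.load 9 (.var 14))))

/-- Approximate multiplication of 0-1 matrices by clustering rows and columns. -/
def approxMultiply (C : ℕ) : Cmd :=
  .seq (computeLength C) (.seq tossVectors (.seq (clusterPoints 0 6 7 0 3 (.var 1) (.const 1))
    (.seq (clusterPoints 1 8 9 2 4 (.const 1) (.var 2)) (.seq multiplyCenters writeOutput))))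

@[simp] theorem wvars_clusterPoints (a cen asg N M : ℕ) (e₁ e₂ : Expr) :
    (clusterPoints a cen asg N M e₁ e₂).wvars = [9, 10, 11, 12, 13, 14, 16, 15, 16, 15, 14, 13,
      17, 18, 19, 20, 13, 16, 14, 16, 14, 20, 17, 13, 18] := rfl
@[simp] theorem warrs_clusterPoints (a cen asg N M : ℕ) (e₁ e₂ : Expr) :
    (clusterPoints a cen asg N M e₁ e₂).warrs = [4, cen, 5, asg] := rfl
@[simp] theorem wvars_computeLength (C : ℕ) : (computeLength C).wvars = [6, 6, 8, 8, 7] := rfl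
@[simp] theorem warrs_computeLength (C : ℕ) : (computeLength C).warrs = [] := rfl
@[simp] theorem wvars_tossVectors : tossVectors.wvars = [13, 21, 13] := rfl
@[simp] theorem warrs_tossVectors : tossVectors.warrs = [3] := rfl
@[simp] theorem wvars_fillArray (a N M : ℕ) (c : Cmd) (e : Expr) :
    (fillArray a N M c e).wvars = 13 :: ((14 :: ((c.wvars ++ []) ++ [14])) ++ [13]) := rfl
@[simp] theorem warrs_fillArray (a N M : ℕ) (c : Cmd) (e : Expr) :
    (fillArray a N M c e).warrs = ((c.warrs ++ [a]) ++ []) ++ [] := rfl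
@[simp] theorem wvars_innerProduct : innerProduct.wvars = [16, 15, 16, 15] := rfl
@[simp] theorem warrs_innerProduct : innerProduct.warrs = [] := rfl

section

variable {w : ℕ} {ω : ℕ → Bool}

/-- The strides are evaluated after some variables have been overwritten, so their values are
required in every memory that agrees with `s` on the input variables. Strides `q, 1` read the rows
of `A` and strides `1, r` the columns of `B`, without a transposition. -/
theorem runs_clusterPoints {a cen asg N M n m q t su sm : ℕ} {e₁ e₂ : Expr} {s : MemState}
    (ha : a < 3) (hcen : 5 < cen) (hasg : 5 < asg) (hne : cen ≠ asg) (hM : M < 6)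
    (hq : s.vars 1 = q) (ht : s.vars 8 = t) (hn : s.vars N = n) (hm : s.vars M = m)
    (he₁ : ∀ s' : MemState, (∀ y < 6, s'.vars y = s.vars y) → e₁.Fits w s' ∧ e₁.val s' = su)
    (he₂ : ∀ s' : MemState, (∀ y < 6, s'.vars y = s.vars y) → e₂.Fits w s' ∧ e₂.val s' = sm)
    (hc₁ : e₁.cost = 1) (hc₂ : e₂.cost = 1)
    (hn0 : 0 < n) (hfit : n * su + q * sm < 2 ^ w) (htq : t * (q * q) < 2 ^ w)
    (htq' : t * q < 2 ^ w) (hnt : n * t + t < 2 ^ w) (hw : q + 2 < 2 ^ w) (hnw : n < 2 ^ w)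
    (hmw : m < 2 ^ w) :
    Runs w ω (clusterPoints a cen asg N M e₁ e₂) s
      (n * (t * (q * 26 + 30) + 14) + m * (n * (t * 70 + 50) + 30) + 24) (fun s' =>
      (∃ far near, FarthestFirst
        (projDist (fun u i => s.arr a (u * su + i * sm)) (s.arr 3) q t) n m far (s'.arr cen) near
        (s'.arr asg)) ∧ (clusterPoints a cen asg N M e₁ e₂).Frame s s') := by
  refine Runs.with_frame ?_
  refine (Runs.seq (Runs.assign (by simp [Expr.Fits]) (Runs.seq (Runs.assign (by simp [Expr.Fits])
    (Runs.seq (Runs.assign (he₁ _ fun y hy => ?_).1 (Runs.seq (Runs.assign (he₂ _ fun y hy => ?_).1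
    (Runs.seq (U := m * (n * (t * 70 + 50) + 30) + 10) ((runs_projectAll (n := n) (q := q) (t := t) (su := su) (sm := sm) ?_ ?_ ?_ ?_ ?_ ha hfit
    htq' hnt (by omega) hnw).mono le_rfl ?_)))))))))).mono_time
    (U := n * (t * (q * 26 + 30) + 14) + m * (n * (t * 70 + 50) + 30) + 24) ?_
  · have h9 : y ≠ 9 := by omega
    have h10 : y ≠ 10 := by omega
    simp [h9, h10]
  · have h9 : y ≠ 9 := by omega
    have h10 : y ≠ 10 := by omega
    have h11 : y ≠ 11 := by omega
    simp [h9, h10, h11]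
  · simp [hq]
  · simp [ht]
  · simp [Expr.val, hn]
  · have : (e₁.val ((s.setVar 9 (Expr.val s (.var N))).setVar 10
        (Expr.val (s.setVar 9 (Expr.val s (.var N))) (.var M)))) = su := by
      refine (he₁ _ fun y hy => ?_).2
      have h9 : y ≠ 9 := by omega
      have h10 : y ≠ 10 := by omega
      simp [h9, h10]
    simpa using this
  · rw [MemState.vars_setVar, if_pos rfl]
    refine (he₂ _ fun y hy => ?_).2
    have h9 : y ≠ 9 := by omega
    have h10 : y ≠ 10 := by omega
    have h11 : y ≠ 11 := by omega
    simp [h9, h10, h11]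
  · rintro s' ⟨hY, hF⟩
    have hM9 : M ≠ 9 := by omega
    simp only [MemState.arr_setVar] at hY
    have hle : ∀ u < n, ∀ j < t, s'.arr 4 (u * t + j) ≤ q := fun u hu j hj => by
      rw [hY u hu j hj]; exact agreements_le _ _ _
    refine (runs_farthestFirst (n := n) (m := m) (t := t) (q := q) (cen := cen) (asg := asg)
      (by rw [hF.vars 8 (by simp)]; simp [ht]) (by rw [hF.vars 9 (by simp)]; simp [Expr.val, hn])
      (by rw [hF.vars 10 (by simp)]; simp [Expr.val, hm, hM9]) hcen hasg hne hn0 (by omega) hnt hnw hmw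
      hle htq (by omega)).mono le_rfl ?_
    rintro s'' ⟨far, near, h⟩
    refine ⟨far, near, h.congr fun u hu v hv => Finset.sum_congr rfl fun j hj => ?_⟩
    rw [hY u hu j (Finset.mem_range.1 hj), hY v hv j (Finset.mem_range.1 hj)]
  · simp only [Expr.cost, hc₁, hc₂]; omega

theorem runs_log_loop (n : ℕ) (s : MemState) (h6 : s.vars 6 = n) (hw : 2 < 2 ^ w)
    (h8 : s.vars 8 + Nat.log 2 n < 2 ^ w) (hn : n < 2 ^ w) :
    Runs w ω (.loop (.op .lt (.const 1) (.var 6))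
        (.seq (.assign 6 (.op .div (.var 6) (.const 2))) (.assign 8 (.op .add (.var 8) (.const 1)))))
      s (Nat.log 2 n * 12 + 4) (fun s' =>
        s'.vars 8 = s.vars 8 + Nat.log 2 n ∧ s'.tossed = s.tossed) := by
  have hfit : (Expr.op .lt (.const 1) (.var 6)).Fits w s :=
    ⟨by simp only [Expr.Fits]; omega, trivial, (BinOp.eval_lt_le_one _ _).trans_lt (by omega)⟩
  induction n using Nat.strong_induction_on generalizing s with
  | _ n ih =>
    by_cases h1 : 1 < n
    · have hlog : Nat.log 2 n = Nat.log 2 (n / 2) + 1 := Nat.log_of_one_lt_of_le (by norm_num) h1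
      have hbody : Runs w ω (.seq (.assign 6 (.op .div (.var 6) (.const 2)))
          (.assign 8 (.op .add (.var 8) (.const 1)))) s 8
          (fun s' => s'.vars 6 = n / 2 ∧ s'.vars 8 = s.vars 8 + 1 ∧ s'.tossed = s.tossed) := by
        refine (Runs.seq (Runs.assign ?_ (Runs.assign ?_ ?_))).mono_time (by simp [Expr.cost])
        · simp only [Expr.Fits, Expr.val, BinOp.eval, h6, true_and]
          omega
        · simp only [Expr.Fits, Expr.val, BinOp.eval, MemState.vars_setVar, Nat.reduceEqDiff,
            if_false, true_and]
          omega
        · simp [Expr.val, BinOp.eval, h6]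
      obtain ⟨t, s₁, he, ht, h6', h8', hT'⟩ := hbody
      obtain ⟨u, s₂, he₂, hu, hq, hT⟩ := ih (n / 2) (by omega) s₁ h6' (by omega) (by omega)
        ⟨by simp only [Expr.Fits]; omega, trivial, (BinOp.eval_lt_le_one _ _).trans_lt (by omega)⟩
      refine ⟨_, s₂, .loop_step ?_ he he₂, ?_, by omega, hT.trans hT'⟩
      · rw [hfit.eval_eq]; simp [Expr.val, BinOp.eval, h6, h1]
      · simp only [Expr.cost]; omega
    · refine ⟨_, s, Exec.loop_stop ?_, ?_, ?_⟩
      · rw [hfit.eval_eq]; simp [Expr.val, BinOp.eval, h6]; omega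
      · simp only [Expr.cost]; omega
      · rw [Nat.log_of_lt (by omega)]; exact ⟨rfl, rfl⟩

/-- Taking the logarithm of `p + r - 1` and not of `p + r` makes `t = 1` for `p = r = 1`. There the
logarithmic terms of the time bound vanish, and there are no two points to compare. -/
theorem runs_computeLength {C p q r e : ℕ} {s : MemState} (h0 : s.vars 0 = p) (h1 : s.vars 1 = q)
    (h2 : s.vars 2 = r) (h5 : s.vars 5 = e) (h8 : s.vars 8 = 0) (hw : 2 < 2 ^ w)
    (hpr : p + r < 2 ^ w) (hC : C < 2 ^ w) (hCe : C * e < 2 ^ w) (hCee : C * e * e < 2 ^ w)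
    (ht : C * e * e * Nat.log 2 (p + r - 1) + 1 < 2 ^ w)
    (htq : (C * e * e * Nat.log 2 (p + r - 1) + 1) * q < 2 ^ w) :
    Runs w ω (computeLength C) s (Nat.log 2 (p + r - 1) * 12 + 30) (fun s' =>
      (s'.vars 8 = C * e * e * Nat.log 2 (p + r - 1) + 1 ∧
      s'.vars 7 = (C * e * e * Nat.log 2 (p + r - 1) + 1) * q ∧ s'.tossed = s.tossed) ∧
      (computeLength C).Frame s s') := by
  refine Runs.with_frame ?_
  have hlog : Nat.log 2 (p + r - 1) ≤ p + r - 1 := Nat.log_le_self _ _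
  have hfit6 : (Expr.op .sub (.op .add (.var 0) (.var 2)) (.const 1)).Fits w s := by
    simp only [Expr.Fits, Expr.val, BinOp.eval, h0, h2, true_and]
    omega
  refine (Runs.seq (Runs.assign hfit6 (Runs.seq (U := 20) ((runs_log_loop (p + r - 1) _
    (by simp [Expr.val, BinOp.eval, h0, h2]) hw (by simp [h8]; omega) (by omega)).with_frame.mono le_rfl
    ?_)))).mono_time (by simp only [Expr.cost]; omega)
  rintro s₁ ⟨⟨h8₁, hT₁⟩, hF⟩
  have h5₁ : s₁.vars 5 = e := by rw [hF.vars 5 (by simp [Cmd.wvars])]; simp [h5]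
  have h1₁ : s₁.vars 1 = q := by rw [hF.vars 1 (by simp [Cmd.wvars])]; simp [h1]
  have h8₁' : s₁.vars 8 = Nat.log 2 (p + r - 1) := by rw [h8₁]; simp [h8]
  refine (Runs.seq (Runs.assign ?_ (Runs.assign ?_ ⟨?_, ?_, ?_⟩))).mono_time (by simp [Expr.cost])
  · simp only [Expr.Fits, Expr.val, BinOp.eval, h5₁, h8₁', true_and]
    omega
  · simp only [Expr.Fits, Expr.val, BinOp.eval, h5₁, h8₁', h1₁, true_and, MemState.vars_setVar,
      if_true, OfNat.one_ne_ofNat, if_false]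
    omega
  · simp [Expr.val, BinOp.eval, h5₁, h8₁']
  · simp [Expr.val, BinOp.eval, h5₁, h8₁', h1₁]
  · simp [hT₁]

/-- No coin is tossed before or after, so entry `x` is exactly coin `x`. Both clusterings use the
same vectors; the union bound needs no independence between them. -/
theorem runs_tossVectors {n : ℕ} {s : MemState} (h7 : s.vars 7 = n) (hT : s.tossed = 0)
    (hn : n < 2 ^ w) :
    Runs w ω tossVectors s (n * 12 + 6) (fun s' =>
      (∀ x < n, s'.arr 3 x = (ω x).toNat) ∧ tossVectors.Frame s s') := by
  refine (Runs.for (T := 4) (fun i s' => (∀ x < i, s'.arr 3 x = (ω x).toNat) ∧ s'.tossed = i) n h7 hn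
    (by simp [Cmd.wvars]) (by simp) (by simp [Cmd.wvars]) (by simp [hT]) ?_).mono le_rfl
      (fun s' h => ⟨h.1.1, h.2⟩)
  rintro i hi s' hF hxi ⟨hI, hT'⟩
  refine (Runs.seq (Runs.toss (Runs.store (by simp [Expr.Fits]) (by simp [Expr.Fits]) ⟨fun x hx => ?_,
    ?_⟩))).mono_time (by simp [Expr.cost])
  · have hv : ∀ (s : MemState) k, ({ s with tossed := k } : MemState).vars = s.vars := fun _ _ => rfl
    have ha : ∀ (s : MemState) k, ({ s with tossed := k } : MemState).arr = s.arr := fun _ _ => rfl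
    simp only [Expr.val, MemState.arr_setVar, MemState.arr_setArr, true_and]
    rw [hT']
    simp only [MemState.setVar, Function.update_self]
    rw [Function.update_of_ne (by norm_num), hxi]
    by_cases hxi' : x = i
    · simp [hxi']
    · rw [if_neg hxi', hI x (by omega)]
  · simp [hT']

theorem runs_fillArray {a N M n m T : ℕ} {c : Cmd} {e : Expr} {f : ℕ → ℕ → ℕ} {s : MemState}
    (hN : s.vars N = n) (hM : s.vars M = m) (hN13 : N < 13) (hM13 : M < 13)
    (hc : ∀ y ∈ c.wvars, 14 < y) (ha : a ∉ c.warrs) (hnw : n < 2 ^ w) (hmw : m < 2 ^ w)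
    (hnm : n * m < 2 ^ w)
    (hstep : ∀ i < n, ∀ j < m, ∀ s' : MemState, (∀ y < 13, s'.vars y = s.vars y) →
      (∀ b, b ≠ a → b ∉ c.warrs → s'.arr b = s.arr b) → s'.vars 13 = i → s'.vars 14 = j →
      Runs w ω c s' T (fun s'' => e.Fits w s'' ∧ e.val s'' = f i j)) :
    Runs w ω (fillArray a N M c e) s (n * (m * (T + e.cost + 16) + 20) + 10) (fun s' =>
      (∀ i < n, ∀ j < m, s'.arr a (i * m + j) = f i j) ∧ (fillArray a N M c e).Frame s s') := by
  have hc13 : 13 ∉ c.wvars := fun h => by have := hc _ h; omega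
  have hc14 : 14 ∉ c.wvars := fun h => by have := hc _ h; omega
  have hcl : ∀ y < 13, y ∉ c.wvars := fun y hy h => by have := hc _ h; omega
  refine (Runs.for (T := m * (T + e.cost + 6 + 8) + 6) (fun i s' => ∀ i' < i, ∀ j < m,
    s'.arr a (i' * m + j) = f i' j) n hN hnw (by simp [Cmd.wvars, hc13]) (by omega)
    (by simp [Cmd.wvars, hcl N hN13]; omega) (by simp) ?_).mono_time (by
      have := Nat.mul_le_mul_left n (show m * (T + e.cost + 6 + 8) + 6 + 8 ≤
        m * (T + e.cost + 16) + 20 by nlinarith)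
      omega)
  intro i hi s₁ hF₁ h13 hI
  have hv₁ : ∀ y < 13, s₁.vars y = s.vars y := fun y hy =>
    hF₁.vars y (by simp [Cmd.wvars, hcl y hy]; omega)
  have ha₁ : ∀ b, b ≠ a → b ∉ c.warrs → s₁.arr b = s.arr b := fun b hb hb' =>
    hF₁.arr b (by simp [Cmd.warrs, hb, hb'])
  refine (Runs.for (T := T + e.cost + 6) (fun j s' => (∀ j' < j, s'.arr a (i * m + j') = f i j') ∧
    ∀ x < i * m, s'.arr a x = s₁.arr a x) m ((hv₁ M hM13).trans hM) hmw (by simp [Cmd.wvars, hc14])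
    (by omega) (by simp [Cmd.wvars, hcl M hM13]) (by simp) ?_).mono le_rfl ?_
  · rintro j hj s₂ hF₂ h14 ⟨hJ, hJ'⟩
    have hv₂ : ∀ y < 13, s₂.vars y = s.vars y := fun y hy =>
      (hF₂.vars y (by simp [Cmd.wvars, hcl y hy]; omega)).trans (hv₁ y hy)
    have h13₂ : s₂.vars 13 = i := (hF₂.vars 13 (by simp [Cmd.wvars, hc13])).trans h13
    have ha₂ : ∀ b, b ≠ a → b ∉ c.warrs → s₂.arr b = s.arr b := fun b hb hb' =>
      (hF₂.arr b (by simp [Cmd.warrs, hb, hb'])).trans (ha₁ b hb hb')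
    refine (Runs.seq (U := e.cost + 6) ((hstep i hi j hj s₂ hv₂ ha₂ h13₂ h14).with_frame.mono le_rfl
      ?_)).mono_time (by omega)
    rintro s₃ ⟨⟨hfit, hval⟩, hF₃⟩
    have h13₃ : s₃.vars 13 = i := (hF₃.vars 13 hc13).trans h13₂
    have h14₃ : s₃.vars 14 = j := (hF₃.vars 14 hc14).trans h14
    have hM₃ : s₃.vars M = m := (hF₃.vars M (hcl M hM13)).trans ((hv₂ M hM13).trans hM)
    have ha₃ : s₃.arr a = s₂.arr a := hF₃.arr a ha
    have hlt := Nat.mul_add_lt_mul_of_lt hi hj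
    refine (Runs.store ?_ hfit ⟨fun j' hj' => ?_, fun x hx => ?_⟩).mono_time
      (by simp only [Expr.cost]; omega)
    · simp only [Expr.Fits, Expr.val, BinOp.eval, h13₃, h14₃, hM₃, true_and]
      omega
    · simp only [Expr.val, BinOp.eval, h13₃, h14₃, hM₃, MemState.arr_setVar, MemState.arr_setArr,
        true_and, hval, ha₃]
      by_cases hjj : j' = j
      · simp [hjj]
      · rw [if_neg (by omega), hJ j' (by omega)]
    · simp only [Expr.val, BinOp.eval, h13₃, h14₃, hM₃, MemState.arr_setVar, MemState.arr_setArr,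
        true_and, ha₃]
      rw [if_neg (by omega), hJ' x hx]
  · rintro s₂ ⟨⟨hJ, hJ'⟩, -⟩ i' hi' j hj
    rw [MemState.arr_setVar]
    by_cases hii : i' = i
    · subst hii; exact hJ j hj
    · rw [hJ' _ (Nat.mul_add_lt_mul_of_lt (by omega) hj), hI i' (by omega) j hj]

theorem runs_innerProduct {q r i j p : ℕ} {s : MemState} (hq : s.vars 1 = q) (hr : s.vars 2 = r)
    (h13 : s.vars 13 = i) (h14 : s.vars 14 = j) (h0 : ∀ x, s.arr 0 x ≤ 1) (h1 : ∀ x, s.arr 1 x ≤ 1)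
    (hi : s.arr 6 i < p) (hj : s.arr 8 j < r) (hpq : p * q < 2 ^ w) (hqr : q * r < 2 ^ w)
    (hqw : q + 2 < 2 ^ w) :
    Runs w ω innerProduct s (q * 30 + 10) (fun s' =>
      s'.vars 16 = ∑ m ∈ Finset.range q,
        s.arr 0 (s.arr 6 i * q + m) * s.arr 1 (m * r + s.arr 8 j)) := by
  refine (Runs.seq (Runs.assign (by simp [Expr.Fits]) ((Runs.for (T := 22) (fun n s' => s'.vars 16 =
    ∑ m ∈ Finset.range n, s.arr 0 (s.arr 6 i * q + m) * s.arr 1 (m * r + s.arr 8 j)) q (by simp [hq])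
    (by omega) (by simp [Cmd.wvars]) (by simp) (by simp [Cmd.wvars]) (by simp [Expr.val]) ?_).mono
    le_rfl fun s' h => h.1))).mono_time (by simp [Expr.cost]; omega)
  intro n hn s' hF hx hI
  -- Entries at most 1 keep every partial sum at most `q`, so it fits into a word.
  have hb : ∀ m, s.arr 0 (s.arr 6 i * q + m) * s.arr 1 (m * r + s.arr 8 j) ≤ 1 := fun m =>
    Nat.mul_le_mul (h0 _) (h1 _)
  have hle : ∑ m ∈ Finset.range n, s.arr 0 (s.arr 6 i * q + m) * s.arr 1 (m * r + s.arr 8 j) ≤ n :=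
    (Finset.sum_le_card_nsmul _ _ 1 fun m _ => hb m).trans (by simp)
  have hbn := hb n
  have hl1 := Nat.mul_add_lt_mul_of_lt hi hn
  have hl2 := Nat.mul_add_lt_mul_of_lt hn hj
  have hv : ∀ y, y ≠ 15 → y ≠ 16 → s'.vars y = s.vars y := fun y h1 h2 => by
    rw [hF.vars y (by simp [Cmd.wvars, h1, h2])]; simp [h2]
  have harr : s'.arr = s.arr := by
    funext b; rw [hF.arr b (by simp [Cmd.warrs])]; rfl
  refine (Runs.assign ?_ ?_).mono_time (by simp [Expr.cost])
  · simp [Expr.Fits, Expr.val, BinOp.eval, harr, hv, hq, hr, h13, h14, hx, hI]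
    omega
  · simp [Expr.val, BinOp.eval, harr, hv, hq, hr, h13, h14, hx, hI, Finset.sum_range_succ]

end

theorem flatten_le_one {m n : ℕ} (M : Matrix (Fin m) (Fin n) Bool) (x : ℕ) : flatten M x ≤ 1 := by
  unfold flatten; split_ifs
  · exact Bool.toNat_le _
  · simp

theorem projDist_congr {X : ℕ → ℕ → ℕ} {R R' : ℕ → ℕ} {q t : ℕ} (h : ∀ x < t * q, R x = R' x)
    (u v : ℕ) : projDist X R q t u v = projDist X R' q t u v := by
  refine Finset.sum_congr rfl fun j hj => ?_
  have : ∀ x : ℕ → ℕ, agreements x (fun m => R (j * q + m)) q =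
      agreements x (fun m => R' (j * q + m)) q := fun x =>
    Finset.sum_congr rfl fun m hm => by
      simp only [h _ (Nat.mul_add_lt_mul_of_lt (Finset.mem_range.1 hj) (Finset.mem_range.1 hm))]
  rw [this, this]

section

variable {w : ℕ} {ω : ℕ → Bool}

/-- This holds for every `ω`: even with bad coins the run is a correct traversal for the projected
distances, which may then be far from the Hamming distances. -/
theorem runs_approxMultiply {C p q r ℓ k e t : ℕ} (A : Matrix (Fin p) (Fin q) Bool)
    (B : Matrix (Fin q) (Fin r) Bool) (hℓ : 1 ≤ ℓ) (hℓp : ℓ ≤ p) (hk : 1 ≤ k) (hkr : k ≤ r)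
    (ht : t = C * e * e * Nat.log 2 (p + r - 1) + 1)
    (hw : 2 < 2 ^ w) (hC : C < 2 ^ w) (hCe : C * e < 2 ^ w) (hCee : C * e * e < 2 ^ w)
    (htqq : t * (q * q) < 2 ^ w) (htq : t * q < 2 ^ w) (hpt : p * t + t < 2 ^ w)
    (hrt : r * t + t < 2 ^ w) (hpq : p * q + q < 2 ^ w) (hqr : r + q * r < 2 ^ w)
    (hpr : p * r < 2 ^ w) (hpr' : p + r < 2 ^ w) (hq : q + 2 < 2 ^ w) :
    Runs w ω (approxMultiply C) (inputState A B ℓ k e)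
      (Nat.log 2 (p + r - 1) * 12 + t * q * 12 +
        (p * (t * (q * 26 + 30) + 14) + ℓ * (p * (t * 70 + 50) + 30)) +
        (r * (t * (q * 26 + 30) + 14) + k * (r * (t * 70 + 50) + 30)) +
        ℓ * (k * (q * 30 + 30) + 20) + p * (r * 30 + 20) + 104)
      (fun s => ∃ far far' near near' cen cen' asg asg',
        FarthestFirst (projDist (fun u i => flatten A (u * q + i)) (fun x => (ω x).toNat) q t) p ℓ far
          cen near asg ∧
        FarthestFirst (projDist (fun u i => flatten B (i * r + u)) (fun x => (ω x).toNat) q t) r k far'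
          cen' near' asg' ∧
        ∀ i < p, ∀ j < r, s.arr 2 (i * r + j) = ∑ m ∈ Finset.range q,
          flatten A (cen (asg i) * q + m) * flatten B (m * r + cen' (asg' j))) := by
  set s₀ := inputState A B ℓ k e with hs₀
  have ht0 : 0 < t := by omega
  -- Each stage hands the unspent time to the rest of the program. The additive constant is `104 =
  -- 30 + 6 + 24 + 24 + 10 + 10`.
  refine (Runs.seq ((runs_computeLength (C := C) (p := p) (q := q) (r := r) (e := e) rfl rfl rfl rfl rfl
    hw hpr' hC hCe hCee (by rw [← ht]; nlinarith) (by rw [← ht]; exact htq)).mono le_rfl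
    (P := fun s₁ => Runs w ω _ s₁ (t * q * 12 +
        (p * (t * (q * 26 + 30) + 14) + ℓ * (p * (t * 70 + 50) + 30)) +
        (r * (t * (q * 26 + 30) + 14) + k * (r * (t * 70 + 50) + 30)) +
        ℓ * (k * (q * 30 + 30) + 20) + p * (r * 30 + 20) + 74) _) ?_)).mono_time (by omega)
  rintro s₁ ⟨⟨h8₁, h7₁, hT₁⟩, hF₁⟩
  rw [← ht] at h8₁ h7₁
  have hv₁ : ∀ y < 6, s₁.vars y = s₀.vars y := fun y hy => hF₁.vars y (by simp; omega)
  have ha₁ : ∀ b, s₁.arr b = s₀.arr b := fun b => hF₁.arr b (by simp)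
  refine (Runs.seq ((runs_tossVectors h7₁ hT₁ htq).mono le_rfl
    (P := fun s₂ => Runs w ω _ s₂ (
        (p * (t * (q * 26 + 30) + 14) + ℓ * (p * (t * 70 + 50) + 30)) +
        (r * (t * (q * 26 + 30) + 14) + k * (r * (t * 70 + 50) + 30)) +
        ℓ * (k * (q * 30 + 30) + 20) + p * (r * 30 + 20) + 68) _) ?_)).mono_time (by omega)
  rintro s₂ ⟨hR, hF₂⟩
  have hv₂ : ∀ y < 9, s₂.vars y = s₁.vars y := fun y hy => hF₂.vars y (by simp; omega)
  have ha₂ : ∀ b, b ≠ 3 → s₂.arr b = s₀.arr b := fun b hb =>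
    (hF₂.arr b (by simp [hb])).trans (ha₁ b)
  have hv₂' : ∀ y < 6, s₂.vars y = s₀.vars y := fun y hy => (hv₂ y (by omega)).trans (hv₁ y hy)
  refine (Runs.seq ((runs_clusterPoints (n := p) (m := ℓ) (q := q) (t := t) (su := q) (sm := 1) (e₁ := .var 1) (e₂ := .const 1)
    (by norm_num) (by norm_num) (by norm_num) (by norm_num) (by norm_num)
    (hv₂' 1 (by norm_num)) ((hv₂ 8 (by norm_num)).trans h8₁) (hv₂' 0 (by norm_num))
    (hv₂' 3 (by norm_num)) (fun s' h => ⟨trivial, (h 1 (by norm_num)).trans (hv₂' 1 (by norm_num))⟩)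
    (fun s' h => ⟨by simp only [Expr.Fits]; omega, rfl⟩) rfl rfl (by omega) (by omega) htqq htq hpt hq
    (by omega) (by omega)).mono le_rfl
    (P := fun s₃ => Runs w ω _ s₃ (
        (r * (t * (q * 26 + 30) + 14) + k * (r * (t * 70 + 50) + 30)) +
        ℓ * (k * (q * 30 + 30) + 20) + p * (r * 30 + 20) + 44) _) ?_)).mono_time (by omega)
  rintro s₃ ⟨⟨far, near, hff⟩, hF₃⟩
  have hv₃ : ∀ y < 9, s₃.vars y = s₂.vars y := fun y hy => hF₃.vars y (by simp; omega)
  have hv₃' : ∀ y < 6, s₃.vars y = s₀.vars y := fun y hy => (hv₃ y (by omega)).trans (hv₂' y hy)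
  have ha₃ : ∀ b < 4, s₃.arr b = s₂.arr b := fun b hb => hF₃.arr b (by simp; omega)
  refine (Runs.seq ((runs_clusterPoints (n := r) (m := k) (q := q) (t := t) (su := 1) (sm := r) (e₁ := .const 1) (e₂ := .var 2)
    (by norm_num) (by norm_num) (by norm_num) (by norm_num) (by norm_num)
    (hv₃' 1 (by norm_num)) ((hv₃ 8 (by norm_num)).trans ((hv₂ 8 (by norm_num)).trans h8₁))
    (hv₃' 2 (by norm_num)) (hv₃' 4 (by norm_num)) (fun s' h => ⟨by simp only [Expr.Fits]; omega, rfl⟩)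
    (fun s' h => ⟨trivial, (h 2 (by norm_num)).trans (hv₃' 2 (by norm_num))⟩) rfl rfl (by omega)
    (by omega) htqq htq hrt hq (by omega) (by omega)).mono le_rfl
    (P := fun s₄ => Runs w ω _ s₄ (
        ℓ * (k * (q * 30 + 30) + 20) + p * (r * 30 + 20) + 20) _) ?_)).mono_time (by omega)
  rintro s₄ ⟨⟨far', near', hff'⟩, hF₄⟩
  have hv₄ : ∀ y < 6, s₄.vars y = s₀.vars y := fun y hy =>
    (hF₄.vars y (by simp; omega)).trans (hv₃' y hy)
  have ha₄ : ∀ b < 4, s₄.arr b = s₃.arr b := fun b hb => hF₄.arr b (by simp; omega)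
  have ha₄₀ : s₄.arr 0 = flatten A := (ha₄ 0 (by norm_num)).trans ((ha₃ 0 (by norm_num)).trans
    (ha₂ 0 (by norm_num)))
  have ha₄₁ : s₄.arr 1 = flatten B := (ha₄ 1 (by norm_num)).trans ((ha₃ 1 (by norm_num)).trans
    (ha₂ 1 (by norm_num)))
  have h6₄ : s₄.arr 6 = s₃.arr 6 := hF₄.arr 6 (by simp)
  have h7₄ : s₄.arr 7 = s₃.arr 7 := hF₄.arr 7 (by simp)
  have hℓk : ℓ * k ≤ p * r := Nat.mul_le_mul hℓp hkr
  refine (Runs.seq ((runs_fillArray (n := ℓ) (m := k) (T := q * 30 + 10)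
    (f := fun i j => ∑ m ∈ Finset.range q,
      flatten A (s₄.arr 6 i * q + m) * flatten B (m * r + s₄.arr 8 j))
    (hv₄ 3 (by norm_num)) (hv₄ 4 (by norm_num)) (by norm_num) (by norm_num) (by simp) (by simp)
    (by omega) (by omega) (by omega) ?_).mono le_rfl (P := fun s₅ => Runs w ω _ s₅ (
        p * (r * 30 + 20) + 10) _) ?_)).mono_time ?_
  · intro i hi j hj s' hv ha h13 h14
    refine (runs_innerProduct (q := q) (r := r) (i := i) (j := j) (p := p)
      ((hv 1 (by norm_num)).trans (hv₄ 1 (by norm_num)))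
      ((hv 2 (by norm_num)).trans (hv₄ 2 (by norm_num))) h13 h14
      (fun x => ?_) (fun x => ?_) ?_ ?_ (by omega) (by nlinarith) hq).mono le_rfl ?_
    · rw [ha 0 (by norm_num) (by simp), ha₄₀]; exact flatten_le_one _ _
    · rw [ha 1 (by norm_num) (by simp), ha₄₁]; exact flatten_le_one _ _
    · rw [ha 6 (by norm_num) (by simp), h6₄]; exact hff.cen_lt i hi
    · rw [ha 8 (by norm_num) (by simp)]; exact hff'.cen_lt j hj
    · intro s'' h
      refine ⟨trivial, ?_⟩
      rw [Expr.val, h, ha 0 (by norm_num) (by simp), ha 1 (by norm_num) (by simp),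
        ha 6 (by norm_num) (by simp), ha 8 (by norm_num) (by simp), ha₄₀, ha₄₁]
  · rintro s₅ ⟨hP, hF₅⟩
    have hv₅ : ∀ y < 6, s₅.vars y = s₀.vars y := fun y hy =>
      (hF₅.vars y (by simp; omega)).trans (hv₄ y hy)
    have ha₅ : ∀ b < 10, s₅.arr b = s₄.arr b := fun b hb => hF₅.arr b (by simp; omega)
    have hasg : ∀ i < p, s₃.arr 7 i < ℓ := hff.asg_lt (by omega)
    have hasg' : ∀ i < r, s₄.arr 9 i < k := hff'.asg_lt (by omega)
    refine (runs_fillArray (n := p) (m := r) (T := 1)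
      (f := fun i j => ∑ m ∈ Finset.range q,
        flatten A (s₄.arr 6 (s₃.arr 7 i) * q + m) * flatten B (m * r + s₄.arr 8 (s₄.arr 9 j)))
      (hv₅ 0 (by norm_num)) (hv₅ 2 (by norm_num)) (by norm_num) (by norm_num) (by simp [Cmd.wvars])
      (by simp [Cmd.warrs]) (by omega) (by omega) (by omega) ?_).mono ?_ ?_
    · intro i hi j hj s' hv ha h13 h14
      have hval7 : s'.arr 7 i = s₃.arr 7 i := by
        rw [ha 7 (by norm_num) (by simp [Cmd.warrs]), ha₅ 7 (by norm_num), h7₄]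
      have hval9 : s'.arr 9 j = s₄.arr 9 j := by
        rw [ha 9 (by norm_num) (by simp [Cmd.warrs]), ha₅ 9 (by norm_num)]
      have hval4 : s'.vars 4 = k := (hv 4 (by norm_num)).trans (hv₅ 4 (by norm_num))
      have hlt := Nat.mul_add_lt_mul_of_lt (hasg i hi) (hasg' j hj)
      refine Runs.skip ⟨?_, ?_⟩
      · simp only [Expr.Fits, Expr.val, BinOp.eval, h13, h14, hval7, hval9, hval4, true_and]
        omega
      · simp only [Expr.val, BinOp.eval, h13, h14, hval7, hval9, hval4]
        rw [ha 10 (by norm_num) (by simp [Cmd.warrs]), hP _ (hasg i hi) _ (hasg' j hj)]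
    · simp only [Expr.cost]
      have := Nat.mul_le_mul_left p (show r * (1 + (1 + 1 + 1 + 1 + (1 + 1) + 1 + 1) + 16) + 20 ≤ r * 30 + 20 by omega)
      omega
    · rintro s₆ ⟨hD, -⟩
      have hA : (fun u i => s₂.arr 0 (u * q + i * 1)) = fun u i => flatten A (u * q + i) := by
        funext u i; rw [ha₂ 0 (by norm_num), mul_one]; rfl
      have hB : (fun u i => s₃.arr 1 (u * 1 + i * r)) = fun u i => flatten B (i * r + u) := by
        funext u i; rw [ha₃ 1 (by norm_num), ha₂ 1 (by norm_num), mul_one, add_comm]; rfl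
      rw [hA] at hff
      rw [hB, ha₃ 3 (by norm_num)] at hff'
      exact ⟨far, far', near, near', s₄.arr 6, s₄.arr 8, s₃.arr 7, s₄.arr 9,
        h6₄ ▸ hff.congr fun u _ v _ => projDist_congr hR u v,
        hff'.congr fun u _ v _ => projDist_congr hR u v, hD⟩
  · simp only [Expr.cost]
    have h1 : ℓ * (k * (q * 30 + 10 + 1 + 16) + 20) ≤ ℓ * (k * (q * 30 + 30) + 20) := by
      exact Nat.mul_le_mul_left _ (Nat.add_le_add_right (Nat.mul_le_mul_left _ (by omega)) _)
    omega

end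

/-! ## Quality of the clustering -/

/-- Infima of nonempty families of natural numbers are attained; `0 < m` makes the inner family
nonempty, and finiteness makes the supremum a genuine upper bound. -/
theorem ciInf_centers {n q : ℕ} (x : Fin n → Fin q → Bool) {m : ℕ} (hm : 0 < m) :
    ∃ T : Fin m → Fin q → Bool, ∀ i, ∃ j, hammingDist (x i) (T j) ≤
      ⨅ T : Fin m → Fin q → Bool, ⨆ i : Fin n, ⨅ j : Fin m, hammingDist (x i) (T j) := by
  have : Nonempty (Fin m) := ⟨⟨0, hm⟩⟩
  obtain ⟨T, hT⟩ := ciInf_mem fun T : Fin m → Fin q → Bool =>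
    ⨆ i : Fin n, ⨅ j : Fin m, hammingDist (x i) (T j)
  refine ⟨T, fun i => ?_⟩
  obtain ⟨j, hj⟩ := ciInf_mem fun j : Fin m => hammingDist (x i) (T j)
  refine ⟨j, ?_⟩
  rw [← hT]
  simp only at hj ⊢
  rw [hj]
  exact le_ciSup (f := fun i => ⨅ j : Fin m, hammingDist (x i) (T j)) (Set.finite_range _).bddAbove i

/-- Pigeonhole: among the `m` centers and `u`, two lie in the same one of the `m` clusters, and
`near u` is at most their distance. -/
theorem FarthestFirst.near_le_of_cluster {d : ℕ → ℕ → ℕ} {n m far : ℕ} {cen near asg : ℕ → ℕ}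
    (h : FarthestFirst d n m far cen near asg) {κ : ℕ → ℕ} (hκ : ∀ u < n, κ u < m) {b : ℕ}
    (hb : ∀ u < n, ∀ v < n, κ u = κ v → d u v ≤ b) {u : ℕ} (hu : u < n) : near u ≤ b := by
  -- `u` is appended as item `m`. The pigeonhole acts on indices, so repeated centers are harmless;
  -- `d` need not be symmetric, so the later index always comes first.
  set f : ℕ → ℕ := fun a => if a < m then cen a else u with hf
  have hfn : ∀ a, f a < n := fun a => by
    simp only [hf]; split_ifs with ha
    · exact h.cen_lt a ha
    · exact hu
  have hsep : ∀ b ≤ m, ∀ a < b, near u ≤ d (f b) (f a) := fun b hb a hab => by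
    simp only [hf]
    rw [if_pos (show a < m by omega)]
    split_ifs with hbm
    · exact h.near_le_cen u hu b hbm a hab
    · exact h.near_le u hu a (by omega)
  obtain ⟨a, ha, a', ha', hne, heq⟩ := Finset.exists_ne_map_eq_of_card_lt_of_maps_to
    (s := Finset.range (m + 1)) (t := Finset.range m) (f := fun a => κ (f a)) (by simp)
    (fun a _ => by simpa using hκ _ (hfn a))
  rw [Finset.mem_range] at ha ha'
  rcases lt_or_gt_of_ne hne with hlt | hlt
  · exact (hsep a' (by omega) a hlt).trans (hb _ (hfn _) _ (hfn _) heq.symm)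
  · exact (hsep a (by omega) a' hlt).trans (hb _ (hfn _) _ (hfn _) heq)

/-- Farthest-first traversal with distances that are accurate up to a factor `1 ± δ` and a scaling
by `t` finds an almost `2`-approximate clustering. -/
theorem FarthestFirst.hammingDist_le {d : ℕ → ℕ → ℕ} {n m q t far : ℕ} {cen near asg : ℕ → ℕ}
    (h : FarthestFirst d n m far cen near asg) (hm : 0 < m) (ht : 0 < t) (x : Fin n → Fin q → Bool)
    {δ ε : ℝ} (hδ : 0 ≤ δ) (hδ8 : 8 * δ ≤ ε) (hε : ε < 1)
    (hd : ∀ u v : Fin n, (1 - δ) * (t * hammingDist (x u) (x v)) ≤ d u v ∧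
      d u v ≤ (1 + δ) * (t * hammingDist (x u) (x v))) (u : Fin n) (c : Fin n)
    (hc : (c : ℕ) = cen (asg u)) :
    (hammingDist (x u) (x c) : ℝ) ≤ (2 + ε) *
      (⨅ T : Fin m → Fin q → Bool, ⨆ i : Fin n, ⨅ j : Fin m, hammingDist (x i) (T j) : ℕ) := by
  obtain ⟨T, hT⟩ := ciInf_centers x hm
  set ρ := ⨅ T : Fin m → Fin q → Bool, ⨆ i : Fin n, ⨅ j : Fin m, hammingDist (x i) (T j)
  choose g hg using hT
  -- The computed distances are natural numbers, so the real bound is rounded down.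
  have key : near u ≤ ⌊(1 + δ) * (t * (2 * ρ : ℝ))⌋₊ := by
    refine h.near_le_of_cluster (κ := fun u => if hu : u < n then g ⟨u, hu⟩ else 0)
      (fun u hu => by simp [hu]) (fun u hu v hv huv => ?_) u.2
    simp only [hu, hv, dif_pos] at huv
    have hguv : g ⟨u, hu⟩ = g ⟨v, hv⟩ := Fin.ext huv
    refine Nat.le_floor (((hd ⟨u, hu⟩ ⟨v, hv⟩).2).trans ?_)
    have h1 : hammingDist (x ⟨u, hu⟩) (x ⟨v, hv⟩) ≤ 2 * ρ := by
      have h2 := hammingDist_triangle (x ⟨u, hu⟩) (T (g ⟨u, hu⟩)) (x ⟨v, hv⟩)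
      have h3 := hg ⟨u, hu⟩
      have h4 := hg ⟨v, hv⟩
      rw [← hguv, hammingDist_comm] at h4
      omega
    have h1' : (hammingDist (x ⟨u, hu⟩) (x ⟨v, hv⟩) : ℝ) ≤ 2 * ρ := by exact_mod_cast h1
    gcongr
  have h1 := (hd u c).1
  rw [hc, ← h.near_eq hm u u.2] at h1
  have h2 : (near u : ℝ) ≤ (1 + δ) * (t * (2 * ρ)) :=
    (Nat.cast_le.2 key).trans (Nat.floor_le (by positivity))
  have ht' : (0 : ℝ) < t := by exact_mod_cast ht
  have h3 : (1 - δ) * hammingDist (x u) (x c) ≤ (1 + δ) * (2 * ρ) := by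
    have := h1.trans h2
    rw [mul_left_comm, mul_left_comm (1 + δ)] at this
    exact le_of_mul_le_mul_left this ht'
  have hρ : (0 : ℝ) ≤ ρ := Nat.cast_nonneg _
  -- The inequality amounts to `4 δ + δ ε ≤ ε`, for which `8 δ ≤ ε < 1` is ample.
  have h4 : (1 + δ) * (2 * ρ) ≤ (1 - δ) * ((2 + ε) * ρ) := by
    have : (1 + δ) * 2 ≤ (1 - δ) * (2 + ε) := by nlinarith
    nlinarith
  exact le_of_mul_le_mul_left (h3.trans h4) (by linarith)

/-- In each coordinate a product of two bits changes by at most the number of factors that change.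
-/
theorem abs_arithProd_sub_le {p q r p' r' : ℕ} (A : Matrix (Fin p) (Fin q) Bool)
    (B : Matrix (Fin q) (Fin r) Bool) (A' : Matrix (Fin p') (Fin q) Bool)
    (B' : Matrix (Fin q) (Fin r') Bool) (i : Fin p) (j : Fin r) (i' : Fin p') (j' : Fin r') :
    |(arithProd A B i j : ℝ) - arithProd A' B' i' j'| ≤ hammingDist (A i) (A' i') +
      hammingDist (fun m => B m j) (fun m => B' m j') := by
  simp only [arithProd, Matrix.mul_apply, Matrix.map_apply, hammingDist, Finset.card_filter,
    Nat.cast_sum]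
  rw [← Finset.sum_sub_distrib, ← Finset.sum_add_distrib]
  refine (Finset.abs_sum_le_sum_abs _ _).trans (Finset.sum_le_sum fun m _ => ?_)
  cases A i m <;> cases A' i' m <;> cases B m j <;> cases B' m j' <;> norm_num

/-! ### Projections as signed sums -/

theorem cast_sqDiff (a b : ℕ) : (sqDiff a b : ℝ) = ((a : ℝ) - b) ^ 2 := by
  unfold sqDiff
  rcases le_total a b with h | h
  · rw [Nat.sub_eq_zero_of_le h]; push_cast [Nat.cast_sub h]; ring
  · rw [Nat.sub_eq_zero_of_le h]; push_cast [Nat.cast_sub h]; ring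

/-- The sign given by a coin. -/
def sign (b : Bool) : ℝ := if b then 1 else -1

/-- The signed sum of the vector `c`. -/
def signedSum {q : ℕ} (c : Fin q → ℝ) (b : Fin q → Bool) : ℝ := ∑ m, c m * sign (b m)

/-- The difference of two 0-1 vectors. -/
def boolDiff {q : ℕ} (x y : Fin q → Bool) (m : Fin q) : ℝ := (x m).toNat - (y m).toNat

theorem sum_boolDiff_sq {q : ℕ} (x y : Fin q → Bool) :
    ∑ m, boolDiff x y m ^ 2 = hammingDist x y := by
  simp only [hammingDist, Finset.card_filter, Nat.cast_sum, boolDiff]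
  refine Finset.sum_congr rfl fun m _ => ?_
  cases x m <;> cases y m <;> norm_num

/-- Where `x u` and `x v` agree, the coin contributes equally to both counts; where they differ,
exactly one of them agrees with the coin, and the contribution is `±1`. -/
theorem cast_projDist {n q t : ℕ} (x : Fin n → Fin q → Bool) {X : ℕ → ℕ → ℕ}
    (hX : ∀ (u : Fin n) (m : Fin q), X u m = (x u m).toNat) (ω : ℕ → Bool) (u v : Fin n) :
    (projDist X (fun i => (ω i).toNat) q t u v : ℝ) = ∑ j : Fin t,
      signedSum (boolDiff (x u) (x v)) (fun m : Fin q => ω (j * q + m)) ^ 2 := by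
  unfold projDist
  push_cast
  rw [Finset.sum_range]
  refine Finset.sum_congr rfl fun j _ => ?_
  rw [cast_sqDiff]
  congr 1
  unfold agreements signedSum
  push_cast
  rw [Finset.sum_range, Finset.sum_range, ← Finset.sum_sub_distrib]
  refine Finset.sum_congr rfl fun m _ => ?_
  rw [hX, hX, boolDiff]
  cases x u m <;> cases x v m <;> cases ω (j * q + m) <;> norm_num [sign]

/-! ## Concentration of signed sums -/

-- The factor `exp (h g²)` merges with the density into another Gaussian integrand; `h < 1 / 2` is
-- the condition for convergence.
open MeasureTheory ProbabilityTheory in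
theorem integral_exp_sq_gaussianReal {h : ℝ} (hh : h < 1 / 2) :
    Integrable (fun g => Real.exp (h * g ^ 2)) (gaussianReal 0 1) ∧
      ∫ g, Real.exp (h * g ^ 2) ∂gaussianReal 0 1 = (√(1 - 2 * h))⁻¹ := by
  have hpdf : ∀ g, gaussianPDFReal 0 1 g * Real.exp (h * g ^ 2) =
      (√(2 * Real.pi))⁻¹ * Real.exp (-(1 / 2 - h) * g ^ 2) := fun g => by
    rw [gaussianPDFReal_def]
    simp only [NNReal.coe_one, mul_one, sub_zero]
    rw [mul_assoc, ← Real.exp_add]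
    congr 2
    ring
  constructor
  · rw [gaussianReal_of_var_ne_zero _ one_ne_zero, gaussianPDF_def,
      integrable_withDensity_iff_integrable_smul' (by fun_prop) (by simp)]
    simp only [smul_eq_mul]
    have : ∀ g, (ENNReal.ofReal (gaussianPDFReal 0 1 g)).toReal * Real.exp (h * g ^ 2) =
        (√(2 * Real.pi))⁻¹ * Real.exp (-(1 / 2 - h) * g ^ 2) := fun g => by
      rw [ENNReal.toReal_ofReal (gaussianPDFReal_nonneg _ _ _), hpdf]
    simp only [this]
    exact (integrable_exp_neg_mul_sq (by linarith)).const_mul _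
  · rw [integral_gaussianReal_eq_integral_smul one_ne_zero]
    simp only [smul_eq_mul, hpdf]
    rw [integral_const_mul, integral_gaussian, ← Real.sqrt_inv, ← Real.sqrt_inv,
      ← Real.sqrt_mul (by positivity)]
    congr 1
    have : 1 / 2 - h ≠ 0 := by linarith
    have : 1 - 2 * h ≠ 0 := by linarith
    field_simp

/-- The sum over all signs factors over the coordinates, and `cosh x ≤ exp (x² / 2)` bounds each
factor. -/
theorem sum_exp_signedSum_le {q : ℕ} (c : Fin q → ℝ) (a : ℝ) :
    ∑ b, Real.exp (a * signedSum c b) ≤ 2 ^ q * Real.exp (a ^ 2 * (∑ m, c m ^ 2) / 2) := by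
  have h1 : ∑ b, Real.exp (a * signedSum c b) = ∏ m, ∑ b : Bool, Real.exp (a * c m * sign b) := by
    rw [Finset.prod_univ_sum, Fintype.piFinset_univ]
    refine Finset.sum_congr rfl fun b _ => ?_
    rw [signedSum, Finset.mul_sum, Real.exp_sum]
    simp only [mul_assoc]
  have h2 : 2 ^ q * Real.exp (a ^ 2 * (∑ m, c m ^ 2) / 2) =
      ∏ m : Fin q, 2 * Real.exp ((a * c m) ^ 2 / 2) := by
    rw [Finset.prod_mul_distrib, ← Real.exp_sum, Finset.prod_const, Finset.card_univ,
      Fintype.card_fin, Finset.mul_sum, Finset.sum_div]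
    simp only [mul_pow]
  rw [h1, h2]
  refine Finset.prod_le_prod (fun m _ => Finset.sum_nonneg fun b _ => (Real.exp_pos _).le)
    fun m _ => ?_
  have := Real.cosh_le_exp_half_sq (a * c m)
  rw [Real.cosh_eq] at this
  simp only [Fintype.univ_bool, Finset.mem_singleton, Bool.true_eq_false, not_false_eq_true,
    Finset.sum_insert, Finset.sum_singleton, sign, if_true, Bool.false_eq_true, if_false, mul_one,
    mul_neg]
  linarith

/-- The squared form of `(1 - 2h)^(-1/2) ≤ exp (h + 2h²)`. The exponential is at least `1 + 2h +
6h²`, and multiplying by `1 - 2h` gives `1 + 2h² - 12h³`, which is at least 1 because `h ≤ 1 / 6`.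
-/
theorem one_le_mul_exp {h : ℝ} (h0 : 0 ≤ h) (h6 : h ≤ 1 / 6) :
    1 ≤ (1 - 2 * h) * Real.exp (2 * (h + 2 * h ^ 2)) := by
  have h1 := Real.quadratic_le_exp_of_nonneg (x := 2 * (h + 2 * h ^ 2)) (by positivity)
  have h2 : 1 + 2 * h + 6 * h ^ 2 ≤ Real.exp (2 * (h + 2 * h ^ 2)) := by
    refine le_trans ?_ h1
    nlinarith [pow_nonneg h0 3, pow_nonneg h0 4]
  calc 1 ≤ (1 - 2 * h) * (1 + 2 * h + 6 * h ^ 2) := by nlinarith [pow_nonneg h0 3, sq_nonneg h]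
    _ ≤ _ := mul_le_mul_of_nonneg_left h2 (by linarith)

-- Linearization by an auxiliary Gaussian `g`: `exp (κ² S² / 2)` is the mean of `exp (κ S g)`. After
-- exchanging sum and integral, the exponent is linear in `S` and the subgaussian bound applies for
-- each fixed `g`; what remains is the integral of `exp (h g²)`.
open MeasureTheory ProbabilityTheory in
theorem sum_exp_sq_le {q : ℕ} (c : Fin q → ℝ) (hN : 0 < ∑ m, c m ^ 2) {h : ℝ} (h0 : 0 ≤ h)
    (h6 : h ≤ 1 / 6) :
    ∑ b, Real.exp (h * (signedSum c b ^ 2 / ∑ m, c m ^ 2)) ≤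
      2 ^ q * Real.exp (h + 2 * h ^ 2) := by
  set N := ∑ m, c m ^ 2
  set κ := √(2 * h / N)
  have hκ : κ ^ 2 = 2 * h / N := Real.sq_sqrt (by positivity)
  have hint : ∀ b, Integrable (fun g => Real.exp (κ * signedSum c b * g)) (gaussianReal 0 1) :=
    fun b => integrable_exp_mul_gaussianReal _
  have hmgf : ∀ b, ∫ g, Real.exp (κ * signedSum c b * g) ∂gaussianReal 0 1 =
      Real.exp (h * (signedSum c b ^ 2 / N)) := fun b => by
    have := congrFun (mgf_id_gaussianReal (μ := 0) (v := 1)) (κ * signedSum c b)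
    simp only [mgf, id] at this
    rw [this, mul_pow, hκ]
    congr 1
    simp only [NNReal.coe_one]
    ring
  simp only [← hmgf]
  rw [← integral_finsetSum _ fun b _ => hint b]
  obtain ⟨hgi, hg⟩ := integral_exp_sq_gaussianReal (h := h) (by linarith)
  calc ∫ g, ∑ b, Real.exp (κ * signedSum c b * g) ∂gaussianReal 0 1
      ≤ ∫ g, 2 ^ q * Real.exp (h * g ^ 2) ∂gaussianReal 0 1 := by
        refine integral_mono (integrable_finsetSum _ fun b _ => hint b) (hgi.const_mul _) fun g => ?_
        have := sum_exp_signedSum_le c (κ * g)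
        rw [mul_pow, hκ, show 2 * h / N * g ^ 2 * (∑ m, c m ^ 2) / 2 = h * g ^ 2 by
          change 2 * h / N * g ^ 2 * N / 2 = h * g ^ 2
          field_simp] at this
        simpa only [mul_right_comm] using this
    _ = 2 ^ q * (√(1 - 2 * h))⁻¹ := by rw [integral_const_mul, hg]
    _ ≤ _ := by
        refine mul_le_mul_of_nonneg_left ?_ (by positivity)
        have hpos : 0 < 1 - 2 * h := by linarith
        have he : √(Real.exp (2 * (h + 2 * h ^ 2))) = Real.exp (h + 2 * h ^ 2) := by
          rw [two_mul, Real.exp_add, Real.sqrt_mul_self (Real.exp_pos _).le]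
        have := Real.sqrt_le_sqrt (one_le_mul_exp h0 h6)
        rw [Real.sqrt_one, Real.sqrt_mul hpos.le, he] at this
        rw [inv_le_iff_one_le_mul₀ (Real.sqrt_pos.2 hpos)]
        linarith

/-- Split off the first sign: the odd powers of `c 0` cancel in the sum over its two values. -/
theorem sum_signedSum_moments {q : ℕ} (c : Fin q → ℝ) :
    ∑ b, signedSum c b ^ 2 = 2 ^ q * ∑ m, c m ^ 2 ∧
      ∑ b, signedSum c b ^ 4 ≤ 2 ^ q * (3 * (∑ m, c m ^ 2) ^ 2) := by
  induction q with
  | zero => simp [signedSum]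
  | succ q ih =>
    obtain ⟨h2, h4⟩ := ih fun m => c m.succ
    have hsum : ∀ f : ℝ → ℝ, ∑ b, f (signedSum c b) =
        ∑ b, (f (c 0 + signedSum (fun m => c m.succ) b) +
          f (-c 0 + signedSum (fun m => c m.succ) b)) := fun f => by
      rw [← (Fin.consEquiv fun _ => Bool).sum_comp, Fintype.sum_prod_type,
        Fintype.sum_bool, ← Finset.sum_add_distrib]
      refine Finset.sum_congr rfl fun b _ => ?_
      simp [signedSum, Fin.sum_univ_succ, Fin.consEquiv, sign]
    set S := signedSum fun m => c m.succ
    set N := ∑ m : Fin q, c m.succ ^ 2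
    have hcard : ∑ _b : Fin q → Bool, (1 : ℝ) = 2 ^ q := by simp
    constructor
    · rw [hsum (fun x => x ^ 2), Fin.sum_univ_succ]
      have : ∀ b, (c 0 + S b) ^ 2 + (-c 0 + S b) ^ 2 = 2 * c 0 ^ 2 * 1 + 2 * S b ^ 2 := fun b => by
        ring
      simp only [this]
      rw [Finset.sum_add_distrib, ← Finset.mul_sum, ← Finset.mul_sum, hcard, h2]
      ring
    · rw [hsum (fun x => x ^ 4), Fin.sum_univ_succ]
      have : ∀ b, (c 0 + S b) ^ 4 + (-c 0 + S b) ^ 4 =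
          2 * c 0 ^ 4 * 1 + 12 * c 0 ^ 2 * S b ^ 2 + 2 * S b ^ 4 := fun b => by ring
      simp only [this]
      rw [Finset.sum_add_distrib, Finset.sum_add_distrib, ← Finset.mul_sum, ← Finset.mul_sum,
        ← Finset.mul_sum, hcard, h2]
      have hp : (0 : ℝ) ≤ 2 ^ q * c 0 ^ 4 := by positivity
      have : (2 : ℝ) ^ (q + 1) * (3 * (c 0 ^ 2 + N) ^ 2) =
        2 * c 0 ^ 4 * 2 ^ q + 12 * c 0 ^ 2 * (2 ^ q * N) + 2 * (2 ^ q * (3 * N ^ 2)) +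
          4 * (2 ^ q * c 0 ^ 4) := by ring
      linarith

/-- `(1 - y + y²/2) (1 + y + y²/2) = 1 + y⁴/4`, and the second factor is at most `exp y`. -/
theorem exp_neg_le_quadratic {y : ℝ} (hy : 0 ≤ y) : Real.exp (-y) ≤ 1 - y + y ^ 2 / 2 := by
  have h1 := Real.quadratic_le_exp_of_nonneg hy
  have h2 : (1 : ℝ) ≤ (1 - y + y ^ 2 / 2) * (1 + y + y ^ 2 / 2) := by nlinarith [sq_nonneg (y ^ 2)]
  rw [Real.exp_neg, inv_le_iff_one_le_mul₀ (Real.exp_pos _)]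
  exact h2.trans (mul_le_mul_of_nonneg_left h1 (by nlinarith [sq_nonneg (y - 1)]))

/-- For the lower tail a quadratic bound on the exponential suffices, since it involves only the
second and fourth moments. -/
theorem sum_exp_neg_sq_le {q : ℕ} (c : Fin q → ℝ) (hN : 0 < ∑ m, c m ^ 2) {h : ℝ} (h0 : 0 ≤ h) :
    ∑ b, Real.exp (-h * (signedSum c b ^ 2 / ∑ m, c m ^ 2)) ≤
      2 ^ q * Real.exp (-h + 2 * h ^ 2) := by
  obtain ⟨h2, h4⟩ := sum_signedSum_moments c
  set N := ∑ m, c m ^ 2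
  calc ∑ b, Real.exp (-h * (signedSum c b ^ 2 / N))
      ≤ ∑ b, (1 - h / N * signedSum c b ^ 2 + h ^ 2 / (2 * N ^ 2) * signedSum c b ^ 4) := by
        refine Finset.sum_le_sum fun b _ => ?_
        rw [neg_mul]
        refine (exp_neg_le_quadratic (by positivity)).trans_eq ?_
        field_simp
    _ = 2 ^ q - h / N * (2 ^ q * N) + h ^ 2 / (2 * N ^ 2) * ∑ b, signedSum c b ^ 4 := by
        rw [Finset.sum_add_distrib, Finset.sum_sub_distrib, ← Finset.mul_sum, ← Finset.mul_sum, h2]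
        simp
    _ ≤ 2 ^ q - h / N * (2 ^ q * N) + h ^ 2 / (2 * N ^ 2) * (2 ^ q * (3 * N ^ 2)) := by gcongr
    _ = 2 ^ q * (1 + (-h + 3 / 2 * h ^ 2)) := by field_simp; ring
    _ ≤ 2 ^ q * Real.exp (-h + 2 * h ^ 2) := by
        refine mul_le_mul_of_nonneg_left ?_ (by positivity)
        have := Real.add_one_le_exp (-h + 2 * h ^ 2)
        nlinarith [sq_nonneg h]

/-- Markov's inequality for products of `t` independent uniformly distributed elements of `β`. -/
theorem card_filter_le_exp {β : Type*} [Fintype β] {t : ℕ} (g : β → ℝ) {κ s : ℝ}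
    (hg : ∑ b, Real.exp (g b) ≤ Fintype.card β * Real.exp κ) :
    ((Finset.univ.filter fun b : Fin t → β => t * (κ + s) ≤ ∑ j, g (b j)).card : ℝ) ≤
      (Fintype.card β : ℝ) ^ t * Real.exp (-(t * s)) := by
  have h1 : ((Finset.univ.filter fun b : Fin t → β => t * (κ + s) ≤ ∑ j, g (b j)).card : ℝ) *
      Real.exp (t * (κ + s)) ≤ ∑ b : Fin t → β, ∏ j, Real.exp (g (b j)) := by
    rw [← nsmul_eq_mul, ← Finset.sum_const]
    refine (Finset.sum_le_sum fun b hb => ?_).trans (Finset.sum_le_univ_sum_of_nonneg fun b =>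
      Finset.prod_nonneg fun j _ => (Real.exp_pos _).le)
    rw [← Real.exp_sum]
    exact Real.exp_le_exp.2 (Finset.mem_filter.1 hb).2
  rw [← Fintype.sum_pow (fun b => Real.exp (g b))] at h1
  have h2 := h1.trans (pow_le_pow_left₀ (Finset.sum_nonneg fun b _ => (Real.exp_pos _).le) hg t)
  rw [mul_pow, ← Real.exp_nat_mul, mul_add, Real.exp_add, ← mul_assoc, mul_right_comm] at h2
  have h3 := le_of_mul_le_mul_right h2 (Real.exp_pos _)
  rw [Real.exp_neg, ← div_eq_mul_inv, le_div_iff₀ (Real.exp_pos _)]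
  simpa only [mul_add] using h3

/-- The sum of `t` squares of signed sums of `c` is rarely far from its expectation. -/
theorem card_filter_not_concentrated_le {q t : ℕ} (c : Fin q → ℝ) (hN : 0 < ∑ m, c m ^ 2) {δ : ℝ}
    (h0 : 0 ≤ δ) (h1 : δ ≤ 1 / 2) :
    ((Finset.univ.filter fun b : Fin t → Fin q → Bool =>
      ¬ ((1 - δ) * (t * ∑ m, c m ^ 2) ≤ ∑ j, signedSum c (b j) ^ 2 ∧
        ∑ j, signedSum c (b j) ^ 2 ≤ (1 + δ) * (t * ∑ m, c m ^ 2))).card : ℝ) ≤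
      (2 ^ q) ^ t * (2 * Real.exp (-(t * (δ ^ 2 / 8)))) := by
  set N := ∑ m, c m ^ 2
  have hcard : ((Fintype.card (Fin q → Bool) : ℕ) : ℝ) = 2 ^ q := by simp
  have hup := card_filter_le_exp (t := t) (s := δ ^ 2 / 8)
    (fun b => δ / 4 * (signedSum c b ^ 2 / N))
    (by rw [hcard]; exact sum_exp_sq_le c hN (h := δ / 4) (by linarith) (by linarith))
  have hlo := card_filter_le_exp (t := t) (s := δ ^ 2 / 8)
    (fun b => -(δ / 4) * (signedSum c b ^ 2 / N))
    (by rw [hcard]; exact sum_exp_neg_sq_le c hN (h := δ / 4) (by linarith))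
  rw [hcard] at hup hlo
  -- With `h = δ / 4` and `s = δ² / 8` the thresholds are exactly `δ/4 · (1 + δ)` and `-δ/4 · (1 -
  -- δ)`, times `t`.
  have hsub : (Finset.univ.filter fun b : Fin t → Fin q → Bool =>
      ¬ ((1 - δ) * (t * N) ≤ ∑ j, signedSum c (b j) ^ 2 ∧
        ∑ j, signedSum c (b j) ^ 2 ≤ (1 + δ) * (t * N))) ⊆
      (Finset.univ.filter fun b : Fin t → Fin q → Bool =>
        t * (δ / 4 + 2 * (δ / 4) ^ 2 + δ ^ 2 / 8) ≤ ∑ j, δ / 4 * (signedSum c (b j) ^ 2 / N)) ∪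
      (Finset.univ.filter fun b : Fin t → Fin q → Bool =>
        t * (-(δ / 4) + 2 * (δ / 4) ^ 2 + δ ^ 2 / 8) ≤
          ∑ j, -(δ / 4) * (signedSum c (b j) ^ 2 / N)) := by
    intro b hb
    simp only [Finset.mem_filter, Finset.mem_univ, true_and, Finset.mem_union, not_and_or,
      not_le] at hb ⊢
    simp only [← Finset.mul_sum, ← Finset.sum_div]
    rcases hb with hb | hb
    · right
      have : (∑ j, signedSum c (b j) ^ 2) / N ≤ (1 - δ) * t := by
        rw [div_le_iff₀ hN]; linarith
      nlinarith
    · left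
      have : (1 + δ) * t ≤ (∑ j, signedSum c (b j) ^ 2) / N := by
        rw [le_div_iff₀ hN]; linarith
      nlinarith
  have h2 := (Finset.card_le_card hsub).trans (Finset.card_union_le _ _)
  have h3 : _ ≤ _ := (Nat.cast_le (α := ℝ)).2 h2
  push_cast at h3
  linarith

/-! ### The coins of the machine -/

-- The indices `j * q + m` run through `0, …, t * q - 1` once each, so the event fixes `t * q`
-- independent coins.
open MeasureTheory in
theorem coinMeasure_singleton_cylinder (t q : ℕ) (b : Fin t → Fin q → Bool) :
    coinMeasure {ω | (fun (j : Fin t) (m : Fin q) => ω (j * q + m)) = b} = (2⁻¹) ^ (t * q) := by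
  set β : ℕ → Bool := fun x => if h : x < t * q then
    b (finProdFinEquiv.symm ⟨x, h⟩).1 (finProdFinEquiv.symm ⟨x, h⟩).2 else false with hβ
  have hset : {ω : ℕ → Bool | (fun (j : Fin t) (m : Fin q) => ω (j * q + m)) = b} =
      Set.pi (Finset.range (t * q)) fun x => {β x} := by
    ext ω
    simp only [Set.mem_ofPred_eq, Set.mem_pi, Finset.coe_range, Set.mem_Iio, Set.mem_singleton_iff]
    constructor
    · rintro rfl x hx
      simp only [hβ, hx, dif_pos]
      congr 1
      have := congrArg Fin.val (finProdFinEquiv.apply_symm_apply (⟨x, hx⟩ : Fin (t * q)))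
      rw [finProdFinEquiv_apply_val] at this
      simp only at this
      rw [mul_comm, add_comm]
      exact this.symm
    · intro h
      funext j m
      have hlt := Nat.mul_add_lt_mul_of_lt j.2 m.2
      rw [h _ hlt]
      have : finProdFinEquiv.symm (⟨j * q + m, hlt⟩ : Fin (t * q)) = (j, m) := by
        rw [Equiv.symm_apply_eq]
        ext
        rw [finProdFinEquiv_apply_val]
        simp only
        ring
      simp only [hβ, hlt, dif_pos, this]
  rw [hset, coinMeasure, Measure.infinitePi_pi _ fun _ _ => MeasurableSet.singleton _]
  simp

open MeasureTheory in
theorem coinMeasure_le_card (t q : ℕ) (E : Finset (Fin t → Fin q → Bool)) :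
    coinMeasure {ω | (fun (j : Fin t) (m : Fin q) => ω (j * q + m)) ∈ E} ≤
      E.card * (2⁻¹) ^ (t * q) := by
  have : {ω : ℕ → Bool | (fun (j : Fin t) (m : Fin q) => ω (j * q + m)) ∈ E} =
      ⋃ b ∈ E, {ω | (fun (j : Fin t) (m : Fin q) => ω (j * q + m)) = b} := by
    ext ω; simp
  rw [this]
  refine (measure_biUnion_finset_le _ _).trans ?_
  simp [coinMeasure_singleton_cylinder]

/-! ## Success probability -/

theorem flatten_mul_add {m n : ℕ} (M : Matrix (Fin m) (Fin n) Bool) (i : Fin m) (j : Fin n) :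
    flatten M (i * n + j) = (M i j).toNat := by
  have hlt := Nat.mul_add_lt_mul_of_lt i.2 j.2
  have : finProdFinEquiv.symm (⟨i * n + j, hlt⟩ : Fin (m * n)) = (i, j) := by
    rw [Equiv.symm_apply_eq]
    ext
    rw [finProdFinEquiv_apply_val]
    simp only
    ring
  rw [flatten, dif_pos hlt, this]

instance : MeasureTheory.IsProbabilityMeasure coinMeasure := by
  unfold coinMeasure; infer_instance

/-- The random projections of the points `X` distort all squared distances by at most `1 ± δ`. -/
def Accurate {n q : ℕ} (x : Fin n → Fin q → Bool) (X : ℕ → ℕ → ℕ) (t : ℕ) (δ : ℝ) (ω : ℕ → Bool) :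
    Prop :=
  ∀ u v : Fin n,
    (1 - δ) * (t * hammingDist (x u) (x v)) ≤ projDist X (fun i => (ω i).toNat) q t u v ∧
    projDist X (fun i => (ω i).toNat) q t u v ≤ (1 + δ) * (t * hammingDist (x u) (x v))

theorem coinMeasure_not_accurate_pair_le {n q t : ℕ} (x : Fin n → Fin q → Bool) {X : ℕ → ℕ → ℕ}
    (hX : ∀ (u : Fin n) (m : Fin q), X u m = (x u m).toNat) {δ : ℝ} (h0 : 0 ≤ δ) (h1 : δ ≤ 1 / 2)
    (u v : Fin n) (huv : x u ≠ x v) :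
    coinMeasure.real {ω | ¬ ((1 - δ) * (t * hammingDist (x u) (x v)) ≤
        projDist X (fun i => (ω i).toNat) q t u v ∧
      projDist X (fun i => (ω i).toNat) q t u v ≤ (1 + δ) * (t * hammingDist (x u) (x v)))} ≤
      2 * Real.exp (-(t * (δ ^ 2 / 8))) := by
  have hN : 0 < ∑ m, boolDiff (x u) (x v) m ^ 2 := by
    rw [sum_boolDiff_sq]
    exact_mod_cast hammingDist_pos.2 huv
  have hcard := card_filter_not_concentrated_le (t := t) (boolDiff (x u) (x v)) hN h0 h1
  have hmeas := coinMeasure_le_card t q (Finset.univ.filter fun b : Fin t → Fin q → Bool =>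
      ¬ ((1 - δ) * (t * ∑ m, boolDiff (x u) (x v) m ^ 2) ≤
          ∑ j, signedSum (boolDiff (x u) (x v)) (b j) ^ 2 ∧
        ∑ j, signedSum (boolDiff (x u) (x v)) (b j) ^ 2 ≤
          (1 + δ) * (t * ∑ m, boolDiff (x u) (x v) m ^ 2)))
  simp only [Finset.mem_filter, Finset.mem_univ, true_and, sum_boolDiff_sq] at hmeas hcard
  simp only [cast_projDist x hX]
  have h2 := ENNReal.toReal_mono (by finiteness) hmeas
  rw [ENNReal.toReal_mul, ENNReal.toReal_natCast, ENNReal.toReal_pow, ENNReal.toReal_inv,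
    ENNReal.toReal_ofNat, inv_pow] at h2
  refine h2.trans ?_
  rw [← div_eq_mul_inv, div_le_iff₀ (by positivity), mul_comm t q, pow_mul,
    mul_comm (2 * Real.exp _)]
  exact hcard

/-- Union bound over ordered pairs. Equal vectors are never distorted, so the diagonal drops out;
the factor `n² - n`, which is 0 for `n = 1`, matters when `p = r = 1` and `t` does not grow. -/
theorem coinMeasure_not_accurate_le {n q t : ℕ} (x : Fin n → Fin q → Bool) {X : ℕ → ℕ → ℕ}
    (hX : ∀ (u : Fin n) (m : Fin q), X u m = (x u m).toNat) {δ : ℝ} (h0 : 0 ≤ δ) (h1 : δ ≤ 1 / 2) :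
    coinMeasure.real {ω | ¬ Accurate x X t δ ω} ≤
      ((n : ℝ) ^ 2 - n) * (2 * Real.exp (-(t * (δ ^ 2 / 8)))) := by
  have hsub : {ω | ¬ Accurate x X t δ ω} ⊆ ⋃ uv ∈ (Finset.univ : Finset (Fin n)).offDiag,
      {ω | x uv.1 ≠ x uv.2 ∧ ¬ ((1 - δ) * (t * hammingDist (x uv.1) (x uv.2)) ≤
        projDist X (fun i => (ω i).toNat) q t uv.1 uv.2 ∧
        projDist X (fun i => (ω i).toNat) q t uv.1 uv.2 ≤
          (1 + δ) * (t * hammingDist (x uv.1) (x uv.2)))} := by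
    intro ω hω
    simp only [Accurate, Set.mem_ofPred_eq, not_forall] at hω
    obtain ⟨u, v, huv⟩ := hω
    have hne : x u ≠ x v := by
      intro h
      refine huv ?_
      rw [cast_projDist x hX]
      simp [h, signedSum, boolDiff]
    simp only [Set.mem_iUnion, Finset.mem_offDiag, Finset.mem_univ, true_and]
    exact ⟨(u, v), fun h => hne (congrArg x h), hne, huv⟩
  refine (MeasureTheory.measureReal_mono hsub (MeasureTheory.measure_ne_top _ _)).trans
    ((MeasureTheory.measureReal_biUnion_finset_le _ _).trans ?_)
  refine (Finset.sum_le_card_nsmul _ _ (2 * Real.exp (-(t * (δ ^ 2 / 8)))) fun uv _ => ?_).trans ?_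
  · by_cases h : x uv.1 = x uv.2
    · simp only [h, ne_eq, not_true_eq_false, false_and, Set.ofPred_false,
        MeasureTheory.measureReal_empty]
      positivity
    · exact (MeasureTheory.measureReal_mono fun ω hω => hω.2).trans
        (coinMeasure_not_accurate_pair_le x hX h0 h1 _ _ h)
  · rw [nsmul_eq_mul, Finset.offDiag_card, Nat.cast_sub (Nat.le_mul_self _)]
    simp [sq]

theorem le_four_pow_log {n : ℕ} (hn : 3 ≤ n) : n ≤ 4 ^ Nat.log 2 (n - 1) := by
  have h1 : n - 1 < 2 ^ (Nat.log 2 (n - 1) + 1) := Nat.lt_pow_succ_log_self (by norm_num) _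
  have h2 : 1 ≤ Nat.log 2 (n - 1) := Nat.log_pos (by norm_num) (by omega)
  have h3 : 2 ^ (Nat.log 2 (n - 1) + 1) ≤ 2 ^ (2 * Nat.log 2 (n - 1)) :=
    Nat.pow_le_pow_right (by norm_num) (by omega)
  rw [pow_mul] at h3
  norm_num at h3
  omega

theorem failure_probability_le {α δ : ℝ} {p r t e C : ℕ} (hα : 1 ≤ α) (hp : 1 ≤ p) (hr : 1 ≤ r)
    (he : 1 ≤ e) (hC : 1024 * (α + 3) ≤ C) (hδ : δ = 1 / (8 * e))
    (ht : C * e * e * Nat.log 2 (p + r - 1) ≤ t) :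
    ((p : ℝ) ^ 2 - p) * (2 * Real.exp (-(t * (δ ^ 2 / 8)))) +
      ((r : ℝ) ^ 2 - r) * (2 * Real.exp (-(t * (δ ^ 2 / 8)))) ≤ 1 / ((p : ℝ) + r) ^ α := by
  have hp' : (1 : ℝ) ≤ p := by exact_mod_cast hp
  have hr' : (1 : ℝ) ≤ r := by exact_mod_cast hr
  -- Here the logarithm is 0 and concentration gives nothing, but there are no pairs that could
  -- fail.
  by_cases h3 : p + r < 3
  · obtain rfl : p = 1 := by omega
    obtain rfl : r = 1 := by omega
    norm_num
    positivity
  set L := Nat.log 2 (p + r - 1)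
  have hn : ((p : ℝ) + r) ≤ 4 ^ L := by exact_mod_cast le_four_pow_log (not_lt.1 h3)
  have hn0 : (0 : ℝ) < p + r := by linarith
  have hlog : Real.log (p + r) ≤ 2 * L := by
    have h4 : Real.log 4 ≤ 2 := by
      rw [show (4 : ℝ) = 2 ^ 2 by norm_num, Real.log_pow]
      have := Real.log_two_lt_d9
      push_cast
      linarith
    calc Real.log (p + r) ≤ Real.log (4 ^ L) := Real.log_le_log hn0 hn
      _ = L * Real.log 4 := by rw [Real.log_pow]
      _ ≤ 2 * L := by nlinarith [Nat.cast_nonneg (α := ℝ) L]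
  have he' : (1 : ℝ) ≤ e := by exact_mod_cast he
  -- `δ² / 8 = 1 / (512 e²)`, and `log (p + r) ≤ 2 L`; this explains the factor `1024 = 2 · 512` in
  -- `C`. The excess 3 over `α` pays for the cubic bound on the number of pairs below.
  have hexp : (α + 3) * Real.log (p + r) ≤ t * (δ ^ 2 / 8) := by
    have ht' : (C : ℝ) * e * e * L ≤ t := by exact_mod_cast ht
    calc (α + 3) * Real.log (p + r) ≤ (α + 3) * (2 * L) := by gcongr
      _ = 1024 * (α + 3) * L / 512 := by ring
      _ ≤ C * L / 512 := by gcongr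
      _ = C * e * e * L * (δ ^ 2 / 8) := by rw [hδ]; field_simp; norm_num
      _ ≤ t * (δ ^ 2 / 8) := by gcongr
  have h2 : ((p : ℝ) ^ 2 - p) * 2 + ((r : ℝ) ^ 2 - r) * 2 ≤ (p + r) ^ 3 := by
    have : (3 : ℝ) ≤ p + r := by exact_mod_cast not_lt.1 h3
    nlinarith [mul_pos hn0 hn0, mul_nonneg (sub_nonneg.2 this) (sq_nonneg ((p : ℝ) + r)),
      mul_nonneg (sub_nonneg.2 hp') (sub_nonneg.2 hr')]
  calc _ = (((p : ℝ) ^ 2 - p) * 2 + ((r : ℝ) ^ 2 - r) * 2) * Real.exp (-(t * (δ ^ 2 / 8))) := by ring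
    _ ≤ (p + r) ^ 3 * Real.exp (-((α + 3) * Real.log (p + r))) := by gcongr
    _ = 1 / ((p : ℝ) + r) ^ α := by
      rw [show -((α + 3) * Real.log (p + r)) = Real.log (p + r) * (-α) + Real.log (p + r) * (-3) by
        ring, Real.exp_add, ← Real.rpow_def_of_pos hn0, ← Real.rpow_def_of_pos hn0, Real.rpow_neg hn0.le,
        Real.rpow_neg hn0.le, show (3 : ℝ) = (3 : ℕ) by norm_num, Real.rpow_natCast]
      field_simp

/-! ## Running time and word length -/

/-- If `r ≤ p²`, then the logarithm is of order `log p`. Otherwise it is of order `log r`, and the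
work for the rows is dominated by that for the columns, because `p ℓ ≤ p² < r`. This covers `p = 1`,
where `p log p` vanishes. -/
theorem log_mul_le {p q r ℓ k : ℕ} (hp : 1 ≤ p) (hr : 1 ≤ r) (hℓ : ℓ ≤ p) (hk : 1 ≤ k) :
    (Nat.log 2 (p + r - 1) : ℝ) * (p * (q + ℓ)) ≤
      6 * (p * Real.log p * (q + ℓ) + r * Real.log r * (q + k)) := by
  have hlogp : 0 ≤ Real.log p := Real.log_natCast_nonneg p
  have hlogr : 0 ≤ Real.log r := Real.log_natCast_nonneg r
  have hL : ∀ (b c : ℕ), p + r - 1 ≤ b ^ c → (Nat.log 2 (p + r - 1) : ℝ) ≤ 2 * (c * Real.log b) := by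
    intro b c hbc
    have h1 : 2 ^ Nat.log 2 (p + r - 1) ≤ b ^ c := (Nat.pow_log_le_self 2 (by omega)).trans hbc
    have h2 : Real.log ((2 : ℝ) ^ Nat.log 2 (p + r - 1)) ≤ Real.log ((b : ℝ) ^ c) :=
      Real.log_le_log (by positivity) (by exact_mod_cast h1)
    rw [Real.log_pow, Real.log_pow] at h2
    have := Real.log_two_gt_d9
    nlinarith [Nat.cast_nonneg (α := ℝ) (Nat.log 2 (p + r - 1))]
  by_cases h : r ≤ p ^ 2
  · have h1 : p + r - 1 ≤ p ^ 3 := by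
      obtain ⟨a, rfl⟩ : ∃ a, p = a + 1 := ⟨p - 1, by omega⟩
      have : (a + 1) ^ 3 = (a + 1) ^ 2 + a + (a ^ 3 + 2 * a ^ 2) := by ring
      omega
    have h2 := hL p 3 h1
    have h3 : (0 : ℝ) ≤ p * (q + ℓ) := by positivity
    have h4 : 0 ≤ r * Real.log r * (q + k) := by positivity
    push_cast at h2
    nlinarith [mul_le_mul_of_nonneg_right h2 h3]
  · have h1 : p + r - 1 ≤ r ^ 2 := by
      have : p ≤ r := by nlinarith
      nlinarith [Nat.sub_le (p + r) 1, Nat.sub_add_cancel (show 1 ≤ p + r by omega),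
        Nat.sub_add_cancel hr]
    have h2 := hL r 2 h1
    have h3 : p * (q + ℓ) ≤ r * (q + k) := by
      have : p ≤ r := by nlinarith
      nlinarith [Nat.mul_le_mul_right q this, Nat.mul_le_mul_left p hℓ, Nat.mul_le_mul_left r hk]
    have h3' : (p : ℝ) * (q + ℓ) ≤ r * (q + k) := by exact_mod_cast h3
    have h4 : 0 ≤ p * Real.log p * (q + ℓ) := by positivity
    have h5 : (0 : ℝ) ≤ r * (q + k) := by positivity
    have h6 := mul_le_mul h2 h3' (by positivity) (by positivity)
    push_cast at h6
    have h7 : 0 ≤ r * Real.log r * (q + k) := by positivity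
    nlinarith

/-- Absorbs the `+ 1` in `t`. For `p ≥ 2` the factor `log p / ε²` is at least 1; for `p = 1` also `ℓ
= 1`, and `q + 1` is covered by `ℓ q k + p r`. -/
theorem mul_le_mul_log_add {p q r ℓ k : ℕ} {ε : ℝ} (hp : 1 ≤ p) (hr : 1 ≤ r) (hℓ1 : 1 ≤ ℓ) (hℓ : ℓ ≤ p)
    (hk : 1 ≤ k) (h0 : 0 < ε) (hε : ε < 1 / 2) :
    (p : ℝ) * (q + ℓ) ≤ p * Real.log p * (q + ℓ) / ε ^ 2 + (ℓ * q * k + p * r) := by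
  by_cases h1 : p = 1
  · subst h1
    obtain rfl : ℓ = 1 := by omega
    have hk' : (1 : ℝ) ≤ k := by exact_mod_cast hk
    have hr' : (1 : ℝ) ≤ r := by exact_mod_cast hr
    simp only [Nat.cast_one, Real.log_one, mul_zero, zero_mul, zero_div, zero_add, one_mul]
    nlinarith [Nat.cast_nonneg (α := ℝ) q]
  · have h2 : Real.log 2 ≤ Real.log p := Real.log_le_log (by norm_num) (by
      exact_mod_cast (show 2 ≤ p by omega))
    have := Real.log_two_gt_d9
    have h3 : 1 ≤ Real.log p / ε ^ 2 := by
      rw [le_div_iff₀ (by positivity)]; nlinarith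
    have h4 : (p : ℝ) * (q + ℓ) * 1 ≤ p * (q + ℓ) * (Real.log p / ε ^ 2) := by gcongr
    have h5 : (p : ℝ) * (q + ℓ) * (Real.log p / ε ^ 2) = p * Real.log p * (q + ℓ) / ε ^ 2 := by ring
    have h6 : (0 : ℝ) ≤ ℓ * q * k + p * r := by positivity
    linarith

/-- `206 = 12 + 44 + 150` collects coin tosses, projections and traversals; 400 is generous for the
rest. -/
theorem running_time_le_nat {p q r ℓ k t L : ℕ} (hℓ : 1 ≤ ℓ) (hℓp : ℓ ≤ p) (hk : 1 ≤ k) (hkr : k ≤ r)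
    (ht1 : 1 ≤ t) (hLn : L ≤ p + r) :
    L * 12 + t * q * 12 +
        (p * (t * (q * 26 + 30) + 14) + ℓ * (p * (t * 70 + 50) + 30)) +
        (r * (t * (q * 26 + 30) + 14) + k * (r * (t * 70 + 50) + 30)) +
        ℓ * (k * (q * 30 + 30) + 20) + p * (r * 30 + 20) + 104 ≤
      206 * (t * (p * (q + ℓ) + r * (q + k))) + 400 * (ℓ * q * k + p * r) := by
  have hp : 1 ≤ p := hℓ.trans hℓp
  have hr : 1 ≤ r := hk.trans hkr
  have e1 : t * q ≤ t * (p * q) := Nat.mul_le_mul_left _ (by nlinarith)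
  have e2 : ∀ n m, 1 ≤ m → n * (t * (q * 26 + 30) + 14) ≤ 44 * (t * (n * (q + m))) := by
    intro n m hm
    have : t * (q * 26 + 30) + 14 ≤ 44 * (t * (q + m)) := by
      nlinarith [Nat.mul_le_mul_left t hm]
    calc _ ≤ n * (44 * (t * (q + m))) := Nat.mul_le_mul_left _ this
      _ = _ := by ring
  have e3 : ∀ n m, 1 ≤ n → m * (n * (t * 70 + 50) + 30) ≤ 150 * (t * (n * m)) := by
    intro n m hn
    have : n * (t * 70 + 50) + 30 ≤ 150 * (t * n) := by
      nlinarith [Nat.mul_le_mul ht1 hn, Nat.mul_le_mul_right n ht1]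
    calc _ ≤ m * (150 * (t * n)) := Nat.mul_le_mul_left _ this
      _ = _ := by ring
  have a1 := e2 p ℓ hℓ
  have a2 := e2 r k hk
  have a3 := e3 p ℓ hp
  have a4 := e3 r k hr
  have hpr1 : p + r ≤ p * r + 1 := by
    obtain ⟨a, rfl⟩ := Nat.exists_eq_add_of_le hp
    obtain ⟨b, rfl⟩ := Nat.exists_eq_add_of_le hr
    nlinarith [Nat.zero_le (a * b)]
  have hℓk : ℓ * k ≤ p * r := Nat.mul_le_mul hℓp hkr
  have hpr0 : 1 ≤ p * r := Nat.mul_le_mul hp hr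
  have hℓr : ℓ ≤ p * r := by nlinarith
  have hppr : p ≤ p * r := by nlinarith
  have b1 : ℓ * (k * (q * 30 + 30) + 20) = 30 * (ℓ * q * k) + 30 * (ℓ * k) + 20 * ℓ := by ring
  have b2 : p * (r * 30 + 20) = 30 * (p * r) + 20 * p := by ring
  have b3 : t * (p * (q + ℓ) + r * (q + k)) =
    t * (p * q) + t * (p * ℓ) + t * (r * (q + k)) := by ring
  have b4 : t * (p * (q + ℓ)) = t * (p * q) + t * (p * ℓ) := by ring
  have b5 : t * (r * k) ≤ t * (r * (q + k)) :=
    Nat.mul_le_mul_left _ (Nat.mul_le_mul_left _ (by omega))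
  omega

/-- In `48 C + 2`, the 48 is 4 from `e² ≤ 4 / ε²` times 12 from two uses of `log_mul_le`; the 2
accounts for the `+ 1` in `t`. -/
theorem running_time_le {C p q r ℓ k e t : ℕ} {ε : ℝ} (hℓ : 1 ≤ ℓ) (hℓp : ℓ ≤ p) (hk : 1 ≤ k)
    (hkr : k ≤ r) (h0 : 0 < ε) (hε : ε < 1 / 2) (he : (e : ℝ) ≤ 1 / ε + 1)
    (ht : t = C * e * e * Nat.log 2 (p + r - 1) + 1) :
    ((Nat.log 2 (p + r - 1) * 12 + t * q * 12 +
        (p * (t * (q * 26 + 30) + 14) + ℓ * (p * (t * 70 + 50) + 30)) +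
        (r * (t * (q * 26 + 30) + 14) + k * (r * (t * 70 + 50) + 30)) +
        ℓ * (k * (q * 30 + 30) + 20) + p * (r * 30 + 20) + 104 : ℕ) : ℝ) ≤
      (206 * (48 * C + 2) + 400) * (p * Real.log p * (q + ℓ) / ε ^ 2 +
        r * Real.log r * (q + k) / ε ^ 2 + ℓ * q * k + p * r) := by
  have hp : 1 ≤ p := hℓ.trans hℓp
  have hr : 1 ≤ r := hk.trans hkr
  have hA := log_mul_le (q := q) hp hr hℓp hk
  have hB := log_mul_le (q := q) hr hp hkr hℓ
  rw [add_comm r p] at hB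
  have hPA := mul_le_mul_log_add (q := q) (k := k) hp hr hℓ hℓp hk h0 hε
  have hPB := mul_le_mul_log_add (q := q) (k := ℓ) hr hp hk hkr hℓ h0 hε
  have hnat := running_time_le_nat (q := q) (t := t) hℓ hℓp hk hkr (by omega)
    ((Nat.log_le_self 2 (p + r - 1)).trans (Nat.sub_le _ _))
  set L := Nat.log 2 (p + r - 1)
  set G := p * Real.log p * (q + ℓ) + r * Real.log r * (q + k) with hG
  have hG0 : 0 ≤ G := by
    have := Real.log_natCast_nonneg p
    have := Real.log_natCast_nonneg r
    positivity
  set M : ℝ := ℓ * q * k + p * r with hM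
  have hM0 : 0 ≤ M := by positivity
  have hF : p * Real.log p * (q + ℓ) / ε ^ 2 + r * Real.log r * (q + k) / ε ^ 2 + ℓ * q * k + p * r =
      G / ε ^ 2 + M := by rw [hG, hM]; ring
  have hP : (p : ℝ) * (q + ℓ) + r * (q + k) ≤ 2 * (G / ε ^ 2 + M) := by
    have : (k : ℝ) * q * ℓ + r * p = M := by rw [hM]; ring
    have h1 : G / ε ^ 2 = p * Real.log p * (q + ℓ) / ε ^ 2 + r * Real.log r * (q + k) / ε ^ 2 := by
      rw [hG]; ring
    have h2 : 0 ≤ G / ε ^ 2 := by positivity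
    linarith
  have hLP : (L : ℝ) * (p * (q + ℓ) + r * (q + k)) ≤ 12 * G := by rw [hG]; linarith
  have hee : (e : ℝ) * e ≤ 4 / ε ^ 2 := by
    have h1 : (e : ℝ) ≤ 2 / ε := by
      have : (1 : ℝ) ≤ 1 / ε := by rw [le_div_iff₀ h0]; linarith
      rw [show 2 / ε = 1 / ε + 1 / ε by ring]
      linarith
    calc (e : ℝ) * e ≤ (2 / ε) * (2 / ε) := by gcongr
      _ = _ := by ring
  have htP : (t : ℝ) * (p * (q + ℓ) + r * (q + k)) ≤ (48 * C + 2) * (G / ε ^ 2 + M) := by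
    have h1 : (t : ℝ) = C * (e * e) * L + 1 := by rw [ht]; push_cast; ring
    have h2 : (C : ℝ) * (e * e) * (L * (p * (q + ℓ) + r * (q + k))) ≤ C * (4 / ε ^ 2) * (12 * G) := by
      gcongr
    have h3 : (C : ℝ) * (4 / ε ^ 2) * (12 * G) = 48 * C * (G / ε ^ 2) := by ring
    have h4 : (0 : ℝ) ≤ 48 * C * M := by positivity
    calc (t : ℝ) * (p * (q + ℓ) + r * (q + k))
        = C * (e * e) * (L * (p * (q + ℓ) + r * (q + k))) + (p * (q + ℓ) + r * (q + k)) := by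
          rw [h1]; ring
      _ ≤ 48 * C * (G / ε ^ 2) + 2 * (G / ε ^ 2 + M) := add_le_add (h2.trans_eq h3) hP
      _ ≤ 48 * C * (G / ε ^ 2) + 2 * (G / ε ^ 2 + M) + 48 * C * M := le_add_of_nonneg_right h4
      _ = (48 * C + 2) * (G / ε ^ 2 + M) := by ring
  rw [hF]
  have hcast : _ ≤ _ := (Nat.cast_le (α := ℝ)).2 hnat
  refine hcast.trans ?_
  push_cast
  have h5 : 0 ≤ G / ε ^ 2 := by positivity
  have h6 : M ≤ G / ε ^ 2 + M := le_add_of_nonneg_left h5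
  calc 206 * ((t : ℝ) * (p * (q + ℓ) + r * (q + k))) + 400 * M
      ≤ 206 * ((48 * C + 2) * (G / ε ^ 2 + M)) + 400 * (G / ε ^ 2 + M) := by gcongr
    _ = (206 * (48 * C + 2) + 400) * (G / ε ^ 2 + M) := by ring

/-- `S` exceeds every input parameter and `X`, a power of `S`, exceeds the program constant `C`, so
overflow checks reduce to comparing monomials in `X` and `S`. -/
theorem two_pow_word_bound {C n w : ℕ} (hn : 5 ≤ n) (hw : (C + 8) * Nat.size n ≤ w) :
    ∃ S X, n < S ∧ C + 1 ≤ X ∧ X * S ^ 6 < 2 ^ w := by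
  have hS : n < 2 ^ Nat.size n := Nat.lt_size_self n
  refine ⟨2 ^ Nat.size n, (2 ^ Nat.size n) ^ C, hS, ?_, ?_⟩
  · exact Nat.lt_pow_self (by omega)
  · rw [← pow_add]
    calc (2 ^ Nat.size n) ^ (C + 6) < (2 ^ Nat.size n) ^ (C + 8) :=
          Nat.pow_lt_pow_right (by omega) (by omega)
      _ = 2 ^ ((C + 8) * Nat.size n) := by rw [← pow_mul, mul_comm]
      _ ≤ 2 ^ w := Nat.pow_le_pow_right (by norm_num) hw

/-! ### Assembly of the main theorem -/

theorem isCenterProduct_of_accurate {p q r ℓ k t : ℕ} (A : Matrix (Fin p) (Fin q) Bool)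
    (B : Matrix (Fin q) (Fin r) Bool) (hℓ : 1 ≤ ℓ) (hk : 1 ≤ k) (ht : 0 < t) {δ ε : ℝ} (hδ : 0 ≤ δ)
    (hδ8 : 8 * δ ≤ ε) (hε : ε < 1) {ω : ℕ → Bool} {s : MemState}
    (hA : Accurate A (fun u i => flatten A (u * q + i)) t δ ω)
    (hB : Accurate (fun j m => B m j) (fun u i => flatten B (i * r + u)) t δ ω)
    (hs : ∃ far far' near near' cen cen' asg asg',
      FarthestFirst (projDist (fun u i => flatten A (u * q + i)) (fun x => (ω x).toNat) q t) p ℓ far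
        cen near asg ∧
      FarthestFirst (projDist (fun u i => flatten B (i * r + u)) (fun x => (ω x).toNat) q t) r k far'
        cen' near' asg' ∧
      ∀ i < p, ∀ j < r, s.arr 2 (i * r + j) = ∑ m ∈ Finset.range q,
        flatten A (cen (asg i) * q + m) * flatten B (m * r + cen' (asg' j))) :
    IsCenterProduct A B ℓ k ε (outputMatrix p r s) ∧
      ∀ i j, |(arithProd A B i j : ℝ) - outputMatrix p r s i j| ≤
        (2 + ε) * (rowRadius A ℓ + colRadius B k) := by
  obtain ⟨far, far', near, near', cen, cen', asg, asg', hff, hff', hD⟩ := hs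
  -- The centers are themselves rows of `A`, while the optimum ranges over arbitrary centers; the
  -- factor 2 pays for this.
  set A' : Matrix (Fin ℓ) (Fin q) Bool := fun a => A ⟨cen a, hff.cen_lt a a.2⟩
  set B' : Matrix (Fin q) (Fin k) Bool := fun m b => B m ⟨cen' b, hff'.cen_lt b b.2⟩
  set σ : Fin p → Fin ℓ := fun i => ⟨asg i, hff.asg_lt hℓ i i.2⟩
  set τ : Fin r → Fin k := fun j => ⟨asg' j, hff'.asg_lt hk j j.2⟩
  have hrow : ∀ i, (hammingDist (A i) (A' (σ i)) : ℝ) ≤ (2 + ε) * rowRadius A ℓ := fun i =>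
    hff.hammingDist_le hℓ ht A hδ hδ8 hε hA i ⟨cen (asg i), hff.cen_lt _ (σ i).2⟩ rfl
  have hcol : ∀ j, (hammingDist (fun m => B m j) (fun m => B' m (τ j)) : ℝ) ≤
      (2 + ε) * colRadius B k := fun j =>
    hff'.hammingDist_le hk ht (fun j m => B m j) hδ hδ8 hε hB j
      ⟨cen' (asg' j), hff'.cen_lt _ (τ j).2⟩ rfl
  have hout : ∀ i j, outputMatrix p r s i j = arithProd A' B' (σ i) (τ j) := fun i j => by
    simp only [outputMatrix, hD i i.2 j j.2, arithProd, Matrix.mul_apply, Matrix.map_apply,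
      Finset.sum_range]
    refine Finset.sum_congr rfl fun m _ => ?_
    exact congrArg₂ (· * ·) (flatten_mul_add A ⟨cen (asg i), hff.cen_lt _ (σ i).2⟩ m)
      (flatten_mul_add B m ⟨cen' (asg' j), hff'.cen_lt _ (τ j).2⟩)
  refine ⟨⟨A', B', σ, τ, hrow, hcol, hout⟩, fun i j => ?_⟩
  rw [hout, mul_add]
  exact (abs_arithProd_sub_le A B A' B' i j (σ i) (τ j)).trans (add_le_add (hrow i) (hcol j))

theorem runs_approxMultiply_of_word_bound {C p q r ℓ k e t w : ℕ} {ω : ℕ → Bool}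
    (A : Matrix (Fin p) (Fin q) Bool) (B : Matrix (Fin q) (Fin r) Bool) (hℓ : 1 ≤ ℓ) (hℓp : ℓ ≤ p)
    (hk : 1 ≤ k) (hkr : k ≤ r) (he : 3 ≤ e) (hw : (C + 8) * Nat.size (p + q + r + e) ≤ w)
    (ht : t = C * e * e * Nat.log 2 (p + r - 1) + 1) :
    Runs w ω (approxMultiply C) (inputState A B ℓ k e)
      (Nat.log 2 (p + r - 1) * 12 + t * q * 12 +
        (p * (t * (q * 26 + 30) + 14) + ℓ * (p * (t * 70 + 50) + 30)) +
        (r * (t * (q * 26 + 30) + 14) + k * (r * (t * 70 + 50) + 30)) +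
        ℓ * (k * (q * 30 + 30) + 20) + p * (r * 30 + 20) + 104)
      (fun s => ∃ far far' near near' cen cen' asg asg',
        FarthestFirst (projDist (fun u i => flatten A (u * q + i)) (fun x => (ω x).toNat) q t) p ℓ far
          cen near asg ∧
        FarthestFirst (projDist (fun u i => flatten B (i * r + u)) (fun x => (ω x).toNat) q t) r k far'
          cen' near' asg' ∧
        ∀ i < p, ∀ j < r, s.arr 2 (i * r + j) = ∑ m ∈ Finset.range q,
          flatten A (cen (asg i) * q + m) * flatten B (m * r + cen' (asg' j))) := by
  obtain ⟨S, X, hS, hX, hXS⟩ := two_pow_word_bound (by omega) hw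
  have hL : Nat.log 2 (p + r - 1) ≤ S := (Nat.log_le_self _ _).trans (by omega)
  have hS1 : 1 ≤ S := by omega
  have hX1 : 1 ≤ X := by omega
  -- Since `t ≤ X S³`, the most demanding product `t q²` is at most `X S⁵`.
  have hCe : C * e * e * Nat.log 2 (p + r - 1) + 1 ≤ X * S ^ 3 := by
    calc C * e * e * Nat.log 2 (p + r - 1) + 1 ≤ C * S * S * S + 1 * S ^ 3 := by
          gcongr
          · omega
          · omega
          · rw [one_mul]; exact Nat.one_le_pow _ _ hS1
      _ = (C + 1) * S ^ 3 := by ring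
      _ ≤ X * S ^ 3 := Nat.mul_le_mul_right _ hX
  rw [← ht] at hCe
  have hpow : ∀ a ≤ 6, S ^ a ≤ X * S ^ 6 := fun a ha =>
    (Nat.pow_le_pow_right hS1 ha).trans (Nat.le_mul_of_pos_left _ hX1)
  have hpow' : ∀ a ≤ 6, X * S ^ a ≤ X * S ^ 6 := fun a ha =>
    Nat.mul_le_mul_left _ (Nat.pow_le_pow_right hS1 ha)
  have h1 := hpow 1 (by norm_num)
  rw [pow_one] at h1
  have h2 := hpow 2 (by norm_num)
  have htS : ∀ n ≤ S, n * t ≤ X * S ^ 4 := fun n hn =>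
    (Nat.mul_le_mul hn hCe).trans_eq (by ring)
  have hnm : ∀ n m, n ≤ S → m ≤ S → n * m ≤ S ^ 2 := fun n m hn hm =>
    (Nat.mul_le_mul hn hm).trans_eq (by ring)
  have h4 := hpow' 4 (by norm_num)
  refine runs_approxMultiply A B hℓ hℓp hk hkr ht (by omega) ?_ ?_ ?_ ?_ ?_ ?_ ?_ ?_ ?_ ?_ (by omega)
    (by omega)
  · have := hpow' 0 (by norm_num)
    rw [pow_zero, mul_one] at this
    omega
  · refine lt_of_le_of_lt ?_ hXS
    calc C * e ≤ X * S := Nat.mul_le_mul (by omega) (by omega)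
      _ = X * S ^ 1 := by ring
      _ ≤ _ := hpow' 1 (by norm_num)
  · refine lt_of_le_of_lt ?_ hXS
    calc C * e * e ≤ X * S * S := Nat.mul_le_mul (Nat.mul_le_mul (by omega) (by omega)) (by omega)
      _ = X * S ^ 2 := by ring
      _ ≤ _ := hpow' 2 (by norm_num)
  · refine lt_of_le_of_lt ?_ hXS
    calc t * (q * q) ≤ X * S ^ 3 * S ^ 2 := Nat.mul_le_mul hCe (hnm _ _ (by omega) (by omega))
      _ = X * S ^ 5 := by ring
      _ ≤ _ := hpow' 5 (by norm_num)
  · rw [mul_comm]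
    exact ((htS q (by omega)).trans h4).trans_lt hXS
  · rw [← Nat.succ_mul]
    exact ((htS (p + 1) (by omega)).trans h4).trans_lt hXS
  · rw [← Nat.succ_mul]
    exact ((htS (r + 1) (by omega)).trans h4).trans_lt hXS
  · rw [← Nat.succ_mul]
    exact ((hnm (p + 1) q (by omega) (by omega)).trans h2).trans_lt hXS
  · rw [add_comm, ← Nat.succ_mul]
    exact ((hnm (q + 1) r (by omega) (by omega)).trans h2).trans_lt hXS
  · exact ((hnm p r (by omega) (by omega)).trans h2).trans_lt hXS

theorem theorem2 (α : ℝ) (hα : 1 ≤ α) :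
    ∃ (prog : Cmd) (c : ℕ) (K : ℝ), 0 < c ∧
      ∀ (p q r ℓ k : ℕ) (A : Matrix (Fin p) (Fin q) Bool) (B : Matrix (Fin q) (Fin r) Bool)
        (ε : ℝ) (w : ℕ),
        1 ≤ ℓ → ℓ ≤ p → 1 ≤ k → k ≤ r → 0 < ε → ε < 1 / 2 →
        c * Nat.size (p + q + r + ⌈1 / ε⌉₊) ≤ w →
        (∀ ω : ℕ → Bool, ∃ (t : ℕ) (s : MemState),
          Exec w ω prog (inputState A B ℓ k ⌈1 / ε⌉₊) t s ∧
          (t : ℝ) ≤ K * (p * Real.log p * (q + ℓ) / ε ^ 2 + r * Real.log r * (q + k) / ε ^ 2 +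
            ℓ * q * k + p * r)) ∧
        1 - 1 / ((p : ℝ) + r) ^ α ≤
          coinMeasure.real {ω | ∃ (t : ℕ) (s : MemState),
            Exec w ω prog (inputState A B ℓ k ⌈1 / ε⌉₊) t s ∧
            IsCenterProduct A B ℓ k ε (outputMatrix p r s) ∧
            ∀ i j, |(arithProd A B i j : ℝ) - outputMatrix p r s i j| ≤
              (2 + ε) * (rowRadius A ℓ + colRadius B k)} := by
  set C := ⌈1024 * (α + 3)⌉₊
  refine ⟨approxMultiply C, C + 8, 206 * (48 * C + 2) + 400, by omega, ?_⟩
  intro p q r ℓ k A B ε w hℓ hℓp hk hkr h0 hε hw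
  have hinv : 2 < 1 / ε := by rw [lt_div_iff₀ h0]; linarith
  have he3 : 3 ≤ ⌈1 / ε⌉₊ := Nat.lt_ceil.2 (by exact_mod_cast hinv)
  have he_le : (⌈1 / ε⌉₊ : ℝ) ≤ 1 / ε + 1 := (Nat.ceil_lt_add_one (by linarith)).le
  have hle_e : 1 / ε ≤ ⌈1 / ε⌉₊ := Nat.le_ceil _
  set e := ⌈1 / ε⌉₊
  set t := C * e * e * Nat.log 2 (p + r - 1) + 1 with ht
  have hrun := fun ω => runs_approxMultiply_of_word_bound (ω := ω) A B hℓ hℓp hk hkr he3 hw ht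
  constructor
  · intro ω
    obtain ⟨t', s, hex, htime, -⟩ := hrun ω
    exact ⟨t', s, hex, (Nat.cast_le.2 htime).trans (running_time_le hℓ hℓp hk hkr h0 hε he_le ht)⟩
  -- The machine knows only the integer `e ≥ 1 / ε`; this gives `8 δ = 1 / e ≤ ε`.
  · set δ : ℝ := 1 / (8 * e) with hδ
    have he0 : (0 : ℝ) < e := by linarith
    have hδ0 : 0 ≤ δ := by positivity
    have hδ8 : 8 * δ ≤ ε := by
      have : 8 * δ = 1 / e := by rw [hδ]; field_simp
      rw [this]
      exact (one_div_le h0 he0).1 hle_e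
    have hδ1 : δ ≤ 1 / 2 := by linarith
    -- Success and the two failure events cover the whole space. Subadditivity then bounds the
    -- success probability from below without any appeal to measurability.
    have hsub : Set.univ ⊆ {ω | ∃ (t : ℕ) (s : MemState),
            Exec w ω (approxMultiply C) (inputState A B ℓ k e) t s ∧
            IsCenterProduct A B ℓ k ε (outputMatrix p r s) ∧
            ∀ i j, |(arithProd A B i j : ℝ) - outputMatrix p r s i j| ≤
              (2 + ε) * (rowRadius A ℓ + colRadius B k)} ∪
        ({ω | ¬ Accurate A (fun u i => flatten A (u * q + i)) t δ ω} ∪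
          {ω | ¬ Accurate (fun j m => B m j) (fun u i => flatten B (i * r + u)) t δ ω}) := by
      intro ω _
      by_cases hA : Accurate A (fun u i => flatten A (u * q + i)) t δ ω
      · by_cases hB : Accurate (fun j m => B m j) (fun u i => flatten B (i * r + u)) t δ ω
        · obtain ⟨t', s, hex, -, hs⟩ := hrun ω
          exact Or.inl ⟨t', s, hex, isCenterProduct_of_accurate A B hℓ hk (by omega) hδ0 hδ8
            (by linarith) hA hB hs⟩
        · exact Or.inr (Or.inr hB)
      · exact Or.inr (Or.inl hA)
    have h1 := (MeasureTheory.measureReal_mono (μ := coinMeasure) hsub).trans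
      ((MeasureTheory.measureReal_union_le _ _).trans
        (add_le_add_right (MeasureTheory.measureReal_union_le _ _) _))
    rw [MeasureTheory.probReal_univ] at h1
    have hA := coinMeasure_not_accurate_le (t := t) A (X := fun u i => flatten A (u * q + i))
      (fun u m => flatten_mul_add A u m) hδ0 hδ1
    have hB := coinMeasure_not_accurate_le (t := t) (fun j m => B m j)
      (X := fun u i => flatten B (i * r + u)) (fun u m => flatten_mul_add B m u) hδ0 hδ1
    have hfail := failure_probability_le (t := t) hα (hℓ.trans hℓp) (hk.trans hkr)
      (show 1 ≤ e by omega) (Nat.le_ceil _) hδ (Nat.le_succ _)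
    linarith
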